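/- Let $\Sigma$ be a finite alphabet. An input word $w\in\Sigma^*$ of length $n$ is written on a read-only tape with cells $0,1,\dots,n+1$, where cell $0$ holds a left endmarker, cells $1,\dots,n$ hold the letters of $w$, and cell $n+1$ holds a right endmarker; a move beyond an endmarker leaves the head in place. For $m\ge 0$, a deterministic $m$-pebble automaton consists of a finite set $Q$ of states, an initial state $q_0\in Q$, a set $A\subseteq Q$ of accepting states, and a transition function $$\delta: Q\times(\Sigma\cup\{\vdash,\dashv\})\times\mathcal P(\{1,\dots,m\})^2\to Q\times\mathcal P(\{1,\dots,m\})^2\times\{-1,0,1\}$$ such that $\delta(q,a,B,C)=(p,D,K,\varepsilon)$ with $B\cap C=\emptyset$ implies $D\cup K=B\cup C$ and $D\cap K=\emptyset$. It starts in state $q_0$ with its head on cell $0$ and all $m$ labeled pebbles available (off the tape). If the state is $q$, the scanned symbol is $a$, $B$ is the set of pebbles on the scanned cell, $C$ is the set of available pebbles and $\delta(q,a,B,C)=(p,D,K,\varepsilon)$, then the automaton changes its state to $p$, makes $D$ the set of pebbles on the scanned cell and $K$ the set of available pebbles (pebbles on other cells stay there), and moves its head by $\varepsilon$. It accepts $w$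 if its computation on $w$ reaches an accepting state. A nondeterministic $m$-pebble automaton is defined in the same way, with a set of possible transitions (each subject to the same condition) in place of the single value of $\delta$; it accepts $w$ if some computation on $w$ reaches an accepting state. Let $\mathcal{REG}_m$ and $\mathcal{NREG}_m$ be the classes of languages over $\Sigma$ accepted by deterministic and by nondeterministic $m$-pebble automata, respectively. Let $\mathcal L$ (Logspace) and $\mathcal{NL}$ be the classes of languages over $\Sigma$ accepted by deterministic, respectively nondeterministic, Turing machines that have a read-only two-way input tape as above and finitely many read-write work tapes over a finite work alphabet, and that visit $O(\log n)$ work-tape cells in every computation on every input of length $n$; here too, a word is accepted if some computation on it reaches an accepting state. Then $$\mathcal L=\bigcup_{m\ge 0}\mathcal{REG}_m\qquad\text{and}\qquad \mathcal{NL}=\bigcup_{m\ge 0}\mathcal{NREG}_m .$$ -/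

import Mathlib

namespace PebbleLogspace

/-- The contents of a cell of the input tape: the input word is enclosed between two endmarkers. -/
inductive Symbol (α : Type*) where
  | leftEnd : Symbol α
  | letter (a : α) : Symbol α
  | rightEnd : Symbol α

/-- The directions `-1`, `0`, `1` in which a head can move. -/
inductive Move where
  | left : Move
  | stay : Move
  | right : Move

/-- The cells of the read-only tape that holds `w`: cell `0` is the left endmarker, the cells
`1, …, |w|` hold the letters of `w`, and cell `|w| + 1` is the right endmarker. -/
abbrev Cell {α : Type*} (w : List α) : Type := Fin (w.length + 2)

/-- The symbol in a cell of the input tape. -/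
def scan {α : Type*} (w : List α) (i : Cell w) : Symbol α :=
  if i.val = 0 then Symbol.leftEnd
  else match w[i.val - 1]? with
    | some a => Symbol.letter a
    | none => Symbol.rightEnd

/-- Movement of the input head. A move beyond an endmarker leaves the head where it is. -/
def Move.onInput {α : Type*} {w : List α} : Move → Cell w → Cell w
  | Move.left, i => ⟨i.val - 1, by have := i.isLt; omega⟩
  | Move.stay, i => i
  | Move.right, i => ⟨min (i.val + 1) (w.length + 1), by omega⟩

/-- Movement of a head on a one-way infinite work tape with cells `0, 1, 2, …`. A move to the left
of cell `0` leaves the head where it is. -/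
def Move.onWork : Move → ℕ → ℕ
  | Move.left, i => i - 1
  | Move.stay, i => i
  | Move.right, i => i + 1

/-! ### Pebble automata -/

/-- A nondeterministic `k`-pebble automaton with input alphabet `α`. The transition
`(p, D, K, ε) ∈ δ q a B C` is possible when the state is `q`, the scanned symbol is `a`, the set of
pebbles on the scanned cell is `B` and the set of available pebbles (those not on the tape) is `C`.
It changes the state to `p`, redistributes the pebbles of `B ∪ C` so that those of `D` are on the
scanned cell and those of `K` are available, and then moves the head in direction `ε`. -/
structure PebbleAutomaton (α : Type*) (k : ℕ) where
  /-- The set of states. -/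
  Q : Type
  finite_Q : Finite Q
  /-- The initial state. -/
  start : Q
  /-- The set of accepting states. -/
  accept : Set Q
  /-- The transitions. -/
  δ : Q → Symbol α → Finset (Fin k) → Finset (Fin k) →
    Set (Q × Finset (Fin k) × Finset (Fin k) × Move)
  pebbles_preserved : ∀ q a B C, Disjoint B C → ∀ p D K ε, (p, D, K, ε) ∈ δ q a B C →
    D ∪ K = B ∪ C ∧ Disjoint D K

namespace PebbleAutomaton

/-- The automaton is deterministic if `δ` is (the graph of) a function. -/
def IsDeterministic {α : Type*} {k : ℕ} (M : PebbleAutomaton α k) : Prop :=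
  ∀ q a B C, ∃! r, r ∈ M.δ q a B C

/-- A configuration on input `w`. `pebble i` is the cell on which pebble `i` lies, or `none` if
pebble `i` is not on the tape. -/
structure Cfg {α : Type*} {k : ℕ} (M : PebbleAutomaton α k) (w : List α) where
  state : M.Q
  head : Cell w
  pebble : Fin k → Option (Cell w)

/-- The initial configuration: the head is on cell `0` and no pebble is on the tape. -/
def init {α : Type*} {k : ℕ} (M : PebbleAutomaton α k) (w : List α) : M.Cfg w where
  state := M.start
  head := 0
  pebble := fun _ => none

/-- The set of pebbles on the scanned cell. -/
def Cfg.here {α : Type*} {k : ℕ} {M : PebbleAutomaton α k} {w : List α} (c : M.Cfg w) :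
    Finset (Fin k) :=
  Finset.univ.filter fun i => c.pebble i = some c.head

/-- The set of available pebbles. -/
def Cfg.available {α : Type*} {k : ℕ} {M : PebbleAutomaton α k} {w : List α} (c : M.Cfg w) :
    Finset (Fin k) :=
  Finset.univ.filter fun i => c.pebble i = none

/-- One step of computation. -/
def Step {α : Type*} {k : ℕ} (M : PebbleAutomaton α k) (w : List α) (c c' : M.Cfg w) : Prop :=
  ∃ p D K ε, (p, D, K, ε) ∈ M.δ c.state (scan w c.head) c.here c.available ∧
    c'.state = p ∧
    c'.head = Move.onInput ε c.head ∧
    ∀ i, c'.pebble i = if i ∈ D then some c.head else if i ∈ K then none else c.pebble i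

/-- The accepted language: the words on which some computation reaches an accepting state. -/
def language {α : Type*} {k : ℕ} (M : PebbleAutomaton α k) : Language α :=
  {w | ∃ c : M.Cfg w, Relation.ReflTransGen (M.Step w) (M.init w) c ∧ c.state ∈ M.accept}

end PebbleAutomaton

/-- The languages over `α` accepted by deterministic `m`-pebble automata. -/
def REG (α : Type*) (m : ℕ) : Set (Language α) :=
  {L | ∃ M : PebbleAutomaton α m, M.IsDeterministic ∧ M.language = L}

/-- The languages over `α` accepted by nondeterministic `m`-pebble automata. -/
def NREG (α : Type*) (m : ℕ) : Set (Language α) :=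
  {L | ∃ M : PebbleAutomaton α m, M.language = L}

/-! ### Turing machines with a read-only input tape -/

/-- A nondeterministic Turing machine with input alphabet `α`, a read-only two-way input tape and
`k` one-way infinite read-write work tapes. The transition `(p, g, ε, η) ∈ δ q a f` is possible
when the state is `q`, the input head scans `a` and the `j`-th work head scans `f j`. It changes
the state to `p`, writes `g j` on the cell scanned on work tape `j`, and moves the input head in
direction `ε` and the `j`-th work head in direction `η j`. The machine halts when no transition is
possible. -/
structure TuringMachine (α : Type*) (k : ℕ) where
  /-- The set of states. -/
  Q : Type
  finite_Q : Finite Q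
  /-- The work alphabet. -/
  Γ : Type
  finite_Γ : Finite Γ
  /-- The blank symbol, which fills the work tapes at the start. -/
  blank : Γ
  /-- The initial state. -/
  start : Q
  /-- The set of accepting states. -/
  accept : Set Q
  /-- The transitions. -/
  δ : Q → Symbol α → (Fin k → Γ) → Set (Q × (Fin k → Γ) × Move × (Fin k → Move))

namespace TuringMachine

/-- The machine is deterministic if at most one transition is possible in every situation. -/
def IsDeterministic {α : Type*} {k : ℕ} (M : TuringMachine α k) : Prop :=
  ∀ q a f, (M.δ q a f).Subsingleton

/-- A configuration on input `w`. -/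
structure Cfg {α : Type*} {k : ℕ} (M : TuringMachine α k) (w : List α) where
  state : M.Q
  head : Cell w
  workHead : Fin k → ℕ
  tape : Fin k → ℕ → M.Γ

/-- The initial configuration: all heads are on cell `0` of their tapes, and the work tapes are
blank. -/
def init {α : Type*} {k : ℕ} (M : TuringMachine α k) (w : List α) : M.Cfg w where
  state := M.start
  head := 0
  workHead := fun _ => 0
  tape := fun _ _ => M.blank

/-- One step of computation. -/
def Step {α : Type*} {k : ℕ} (M : TuringMachine α k) (w : List α) (c c' : M.Cfg w) : Prop :=
  ∃ p g ε η, (p, g, ε, η) ∈ M.δ c.state (scan w c.head) (fun j => c.tape j (c.workHead j)) ∧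
    c'.state = p ∧
    c'.head = Move.onInput ε c.head ∧
    (∀ j, c'.workHead j = Move.onWork (η j) (c.workHead j)) ∧
    ∀ j, c'.tape j = Function.update (c.tape j) (c.workHead j) (g j)

/-- `c` occurs in some computation on input `w`. -/
def Reachable {α : Type*} {k : ℕ} (M : TuringMachine α k) (w : List α) (c : M.Cfg w) : Prop :=
  Relation.ReflTransGen (M.Step w) (M.init w) c

/-- The accepted language: the words on which some computation reaches an accepting state. -/
def language {α : Type*} {k : ℕ} (M : TuringMachine α k) : Language α :=
  {w | ∃ c : M.Cfg w, M.Reachable w c ∧ c.state ∈ M.accept}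

/-- The machine works in space `s`: in every computation on a word of length `n`, at most the first
`s n` cells of each work tape are visited. -/
def SpaceBound {α : Type*} {k : ℕ} (M : TuringMachine α k) (s : ℕ → ℕ) : Prop :=
  ∀ (w : List α) (c : M.Cfg w), M.Reachable w c → ∀ j, c.workHead j < s w.length

/-- The machine works in space `O(log n)`. The summand `1` only matters for words of length at
most `1`, for which `log n` is not positive. -/
def IsLogspace {α : Type*} {k : ℕ} (M : TuringMachine α k) : Prop :=
  ∃ b : ℕ, M.SpaceBound fun n => b * (Nat.log 2 n + 1)

end TuringMachine

/-- The class Logspace of languages over `α`. -/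
def LOGSPACE (α : Type*) : Set (Language α) :=
  {L | ∃ (k : ℕ) (M : TuringMachine α k), M.IsDeterministic ∧ M.IsLogspace ∧ M.language = L}

/-- The class NL of languages over `α`. -/
def NLOGSPACE (α : Type*) : Set (Language α) :=
  {L | ∃ (k : ℕ) (M : TuringMachine α k), M.IsLogspace ∧ M.language = L}

end PebbleLogspace

/-!
A logspace machine is simulated by pebbles as follows. The `O(log n)` cells of its work tapes are
cut into columns of constant height, so that there are at most `log (n + 2)` columns, and each row,
written in binary, splits at the work head into two words of at most this length. These words are
numbers of size at most `n + 1`, that is, positions of pebbles. The work head moves by doubling and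
halving such numbers, which an automaton can do in unary with the help of an auxiliary pebble.
Conversely, a Turing machine stores the positions of the head and of the pebbles in binary on a
work tape and counts when the head moves.

Both simulations are written as while programs over a device with observable states, and a program
becomes a finite automaton whose states are the programs that remain to be executed.
-/

namespace PebbleLogspace

/-! ### While programs over an abstract device -/

/-- A device with stores `S`, to be controlled by a finite-state program: the program sees a store
only through `obs`, and changes it only by the actions in `A`. -/
structure Device (O A S : Type*) where
  /-- The part of the store that is visible to the program. -/
  obs : S → O
  /-- The effect of an action. -/
  act : A → S → S

/-- Perform an optional action. -/
def Device.run {O A S : Type*} (d : Device O A S) : Option A → S → S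
  | none, s => s
  | some a, s => d.act a s

/-- Nondeterministic while programs with memory `F`, for devices with observations `O` and
actions `A`. A basic step `act f` chooses a new memory and an optional action among those that `f`
allows. -/
inductive Prog (F O A : Type*) where
  | skip : Prog F O A
  | act (f : F → O → Set (F × Option A)) : Prog F O A
  | seq (p q : Prog F O A) : Prog F O A
  | ite (t : F → O → Prop) (p q : Prog F O A) : Prog F O A
  | loop (t : F → O → Prop) (p : Prog F O A) : Prog F O A

namespace Prog

variable {F O A S : Type*}

/-- The transitions of a program: `Next p m o p' m' a` says that with memory `m` and observation
`o` the program `p` can perform `a`, change the memory to `m'` and continue as `p'`. -/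
inductive Next : Prog F O A → F → O → Prog F O A → F → Option A → Prop
  | act {f m o m' a} (h : (m', a) ∈ f m o) : Next (act f) m o skip m' a
  | seqSkip {q m o} : Next (seq skip q) m o q m none
  | seq {p q m o p' m' a} (h : Next p m o p' m' a) : Next (seq p q) m o (seq p' q) m' a
  | iteTrue {t p q m o} (h : t m o) : Next (ite t p q) m o p m none
  | iteFalse {t p q m o} (h : ¬ t m o) : Next (ite t p q) m o q m none
  | loopTrue {t p m o} (h : t m o) : Next (loop t p) m o (seq p (loop t p)) m none
  | loopFalse {t p m o} (h : ¬ t m o) : Next (loop t p) m o skip m none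

/-- One step of a program together with its memory and store. -/
def Step (d : Device O A S) (x y : Prog F O A × F × S) : Prop :=
  ∃ a, Next x.1 x.2.1 (d.obs x.2.2) y.1 y.2.1 a ∧ y.2.2 = d.run a x.2.2

/-- Any number of steps of a program together with its memory and store. -/
abbrev Reach (d : Device O A S) : Prog F O A × F × S → Prog F O A × F × S → Prop :=
  Relation.ReflTransGen (Step d)

/-- `Exec d P p s T` says that all stores that occur when `p` is started in `s` satisfy `P`, and
that `T` is the set of states in which `p` can terminate. -/
structure Exec (d : Device O A S) (P : S → Prop) (p : Prog F O A) (s : F × S)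
    (T : Set (F × S)) : Prop where
  safe : ∀ y, Reach d (p, s) y → P y.2.2
  outcome : ∀ s', Reach d (p, s) (skip, s') ↔ s' ∈ T

variable {d : Device O A S} {P : S → Prop} {p q : Prog F O A} {s r : F × S}
  {t : F → O → Prop} {T : Set (F × S)}

theorem Exec.start (h : Exec d P p s T) : P s.2 :=
  h.safe _ .refl

theorem not_step_skip (s : F × S) (y : Prog F O A × F × S) : ¬ Step d (skip, s) y := by
  rintro ⟨a, h, -⟩
  cases h

theorem Step.seq {p' : Prog F O A} {s' : F × S} (q : Prog F O A)
    (h : Step d (p, s) (p', s')) : Step d (seq p q, s) (seq p' q, s') := by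
  obtain ⟨a, h, h'⟩ := h
  exact ⟨a, .seq h, h'⟩

theorem step_seq_skip_iff {y : Prog F O A × F × S} :
    Step d (seq skip q, s) y ↔ y = (q, s) := by
  constructor
  · obtain ⟨q', m', s'⟩ := y
    rintro ⟨a, h, hs⟩
    dsimp only at h hs
    cases h with
    | seqSkip => subst hs; rfl
    | seq h => cases h
  · rintro rfl
    exact ⟨none, .seqSkip, rfl⟩

theorem Step.of_seq {y : Prog F O A × F × S} (h : Step d (.seq p q, s) y) :
    p = skip ∧ y = (q, s) ∨ ∃ p', y.1 = .seq p' q ∧ Step d (p, s) (p', y.2) := by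
  obtain ⟨q', m', s'⟩ := y
  obtain ⟨a, h, hs⟩ := h
  dsimp only at h hs
  cases h with
  | seqSkip => subst hs; exact Or.inl ⟨rfl, rfl⟩
  | seq h => exact Or.inr ⟨_, rfl, a, h, hs⟩

theorem Reach.seq {p' : Prog F O A} {s' : F × S} (q : Prog F O A)
    (h : Reach d (p, s) (p', s')) : Reach d (seq p q, s) (seq p' q, s') :=
  h.lift (fun x : Prog F O A × F × S => (Prog.seq x.1 q, x.2)) fun _ _ h => Step.seq q h

theorem Reach.seq_trans {y : Prog F O A × F × S} (hp : Reach d (p, s) (skip, r))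
    (hq : Reach d (q, r) y) : Reach d (.seq p q, s) y :=
  (Reach.seq q hp).trans (.head (step_seq_skip_iff.2 rfl) hq)

theorem Reach.of_seq {y : Prog F O A × F × S} (h : Reach d (.seq p q, s) y) :
    (∃ p', y.1 = .seq p' q ∧ Reach d (p, s) (p', y.2)) ∨
      ∃ r, Reach d (p, s) (skip, r) ∧ Reach d (q, r) y := by
  induction h with
  | refl => exact Or.inl ⟨p, rfl, .refl⟩
  | @tail y z _ h ih =>
    obtain ⟨py, sy⟩ := y
    rcases ih with ⟨p', rfl, hp⟩ | ⟨r, hp, hq⟩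
    · rcases h.of_seq with ⟨rfl, rfl⟩ | ⟨p'', hz, h⟩
      · exact Or.inr ⟨sy, hp, .refl⟩
      · exact Or.inl ⟨p'', hz, hp.tail h⟩
    · exact Or.inr ⟨r, hp, hq.tail h⟩

theorem Exec.skip (hs : P s.2) : Exec d P (skip : Prog F O A) s {s} := by
  have reach_iff : ∀ y, Reach d (Prog.skip, s) y ↔ y = (Prog.skip, s) := fun y =>
    Relation.reflTransGen_iff_eq fun z => not_step_skip s z
  refine ⟨fun y hy => ?_, fun s' => ?_⟩
  · rw [(reach_iff y).1 hy]
    exact hs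
  · simp only [reach_iff, Prod.mk.injEq, true_and, Set.mem_singleton_iff]

theorem Exec.head {U : Prog F O A × F × S → Set (F × S)} (hs : P s.2) (hp : p ≠ Prog.skip)
    (h : ∀ y, Step d (p, s) y → Exec d P y.1 y.2 (U y)) :
    Exec d P p s {s' | ∃ y, Step d (p, s) y ∧ s' ∈ U y} := by
  refine ⟨fun y hy => ?_, fun s' => ⟨fun hy => ?_, ?_⟩⟩
  · rcases hy.cases_head with rfl | ⟨z, hz, hy⟩
    exacts [hs, (h z hz).safe y hy]
  · rcases hy.cases_head with h' | ⟨z, hz, hy⟩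
    exacts [absurd (congrArg Prod.fst h') hp, ⟨z, hz, ((h z hz).outcome s').1 hy⟩]
  · rintro ⟨z, hz, hy⟩
    exact .head hz (((h z hz).outcome s').2 hy)

theorem Exec.head_of_unique (hs : P s.2) (hp : p ≠ Prog.skip)
    (h : ∀ y, Step d (p, s) y ↔ y = (q, r)) (hq : Exec d P q r T) : Exec d P p s T := by
  convert Exec.head (U := fun _ => T) hs hp fun y hy => by
    rw [(h y).1 hy]
    exact hq
  ext s'
  exact ⟨fun hs' => ⟨_, (h _).2 rfl, hs'⟩, fun ⟨_, _, hs'⟩ => hs'⟩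

theorem Exec.act {f : F → O → Set (F × Option A)} (hs : P s.2)
    (h : ∀ m a, (m, a) ∈ f s.1 (d.obs s.2) → P (d.run a s.2)) :
    Exec d P (act f) s ((fun x => (x.1, d.run x.2 s.2)) '' f s.1 (d.obs s.2)) := by
  have step_iff : ∀ y, Step d (Prog.act f, s) y ↔
      ∃ x ∈ f s.1 (d.obs s.2), y = (Prog.skip, x.1, d.run x.2 s.2) := by
    rintro ⟨p, m, r⟩
    constructor
    · rintro ⟨a, hn, rfl⟩
      cases hn with | act hn => exact ⟨_, hn, rfl⟩
    · rintro ⟨⟨m, a⟩, hx, hy⟩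
      cases hy
      exact ⟨a, .act hx, rfl⟩
  convert Exec.head (p := .act f) (U := fun y => {y.2}) hs (by simp) fun y hy => ?_
  · ext s'
    simp only [step_iff, Set.mem_image, Set.mem_ofPred_eq, Set.mem_singleton_iff]
    constructor
    · rintro ⟨x, hx, rfl⟩
      exact ⟨_, ⟨x, hx, rfl⟩, rfl⟩
    · rintro ⟨_, ⟨x, hx, rfl⟩, rfl⟩
      exact ⟨x, hx, rfl⟩
  · obtain ⟨x, hx, rfl⟩ := (step_iff y).1 hy
    exact .skip (h x.1 x.2 hx)

theorem Exec.act_of_eq_singleton {f : F → O → Set (F × Option A)} {m : F} {a : Option A}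
    (hf : f s.1 (d.obs s.2) = {(m, a)}) (hs : P s.2) (h : P (d.run a s.2)) :
    Exec d P (.act f) s {(m, d.run a s.2)} := by
  have := Exec.act (d := d) (f := f) hs fun m' a' h' => by
    rw [hf] at h'
    cases h'
    exact h
  rwa [hf, Set.image_singleton] at this

theorem Exec.seq {ι : Type*} {I : Set ι} {g : ι → F × S} {U : ι → Set (F × S)}
    (hp : Exec d P p s (g '' I)) (hq : ∀ i ∈ I, Exec d P q (g i) (U i)) :
    Exec d P (.seq p q) s (⋃ i ∈ I, U i) := by
  refine ⟨fun y hy => ?_, fun s' => ?_⟩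
  · rcases hy.of_seq with ⟨p', -, h⟩ | ⟨r, hr, h⟩
    · exact hp.safe (p', y.2) h
    · obtain ⟨i, hi, rfl⟩ := (hp.outcome r).1 hr
      exact (hq i hi).safe y h
  · simp only [Set.mem_iUnion, exists_prop]
    constructor
    · intro h
      rcases h.of_seq with ⟨p', h, -⟩ | ⟨r, hr, h⟩
      · cases h
      · obtain ⟨i, hi, rfl⟩ := (hp.outcome r).1 hr
        exact ⟨i, hi, ((hq i hi).outcome s').1 h⟩
    · rintro ⟨i, hi, h⟩
      exact Reach.seq_trans ((hp.outcome _).2 ⟨i, hi, rfl⟩) (((hq i hi).outcome s').2 h)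

theorem Exec.seq_image {ι : Type*} {I : Set ι} {g g' : ι → F × S} (hp : Exec d P p s (g '' I))
    (hq : ∀ i ∈ I, Exec d P q (g i) {g' i}) : Exec d P (.seq p q) s (g' '' I) := by
  rw [Set.image_eq_iUnion]
  exact hp.seq hq

theorem Exec.seq_singleton (hp : Exec d P p s {r}) (hq : Exec d P q r T) :
    Exec d P (.seq p q) s T := by
  rw [← Set.image_id {r}] at hp
  simpa only [Set.mem_singleton_iff, Set.iUnion_iUnion_eq_left] using
    hp.seq (U := fun _ => T) fun i hi => by rwa [Set.mem_singleton_iff.1 hi]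

theorem Exec.iteTrue (h : t s.1 (d.obs s.2)) (hp : Exec d P p s T) :
    Exec d P (.ite t p q) s T := by
  refine Exec.head_of_unique hp.start (by simp) (fun y => ⟨?_, ?_⟩) hp
  · obtain ⟨p', m', s'⟩ := y
    rintro ⟨a, hn, rfl⟩
    dsimp only at hn
    cases hn with
    | iteTrue => rfl
    | iteFalse h' => exact absurd h h'
  · rintro rfl
    exact ⟨none, .iteTrue h, rfl⟩

theorem Exec.iteFalse (h : ¬ t s.1 (d.obs s.2)) (hq : Exec d P q s T) :
    Exec d P (.ite t p q) s T := by
  refine Exec.head_of_unique hq.start (by simp) (fun y => ⟨?_, ?_⟩) hq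
  · obtain ⟨p', m', s'⟩ := y
    rintro ⟨a, hn, rfl⟩
    dsimp only at hn
    cases hn with
    | iteTrue h' => exact absurd h' h
    | iteFalse => rfl
  · rintro rfl
    exact ⟨none, .iteFalse h, rfl⟩

theorem step_loop_iff_of_true (h : t s.1 (d.obs s.2)) {y : Prog F O A × F × S} :
    Step d (loop t p, s) y ↔ y = (seq p (loop t p), s) := by
  constructor
  · obtain ⟨p', m', s'⟩ := y
    rintro ⟨a, hn, rfl⟩
    cases hn with
    | loopTrue => rfl
    | loopFalse h' => exact absurd h h'
  · rintro rfl
    exact ⟨none, .loopTrue h, rfl⟩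

theorem step_loop_iff_of_false (h : ¬ t s.1 (d.obs s.2)) {y : Prog F O A × F × S} :
    Step d (loop t p, s) y ↔ y = (skip, s) := by
  constructor
  · obtain ⟨p', m', s'⟩ := y
    rintro ⟨a, hn, rfl⟩
    cases hn with
    | loopTrue h' => exact absurd h' h
    | loopFalse => rfl
  · rintro rfl
    exact ⟨none, .loopFalse h, rfl⟩

theorem Exec.loopTrue (h : t s.1 (d.obs s.2)) (hp : Exec d P (.seq p (.loop t p)) s T) :
    Exec d P (.loop t p) s T :=
  .head_of_unique hp.start (by simp) (fun _ => step_loop_iff_of_true h) hp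

theorem Exec.loopFalse (hs : P s.2) (h : ¬ t s.1 (d.obs s.2)) : Exec d P (.loop t p) s {s} :=
  .head_of_unique hs (by simp) (fun _ => step_loop_iff_of_false h) (.skip hs)

theorem Exec.loop_of_sequence (n : ℕ) (g : ℕ → F × S)
    (ht : ∀ i < n, t (g i).1 (d.obs (g i).2)) (hn : ¬ t (g n).1 (d.obs (g n).2))
    (hp : ∀ i < n, Exec d P p (g i) {g (i + 1)}) (hP : P (g n).2) :
    Exec d P (.loop t p) (g 0) {g n} := by
  induction n generalizing g with
  | zero => exact .loopFalse hP hn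
  | succ n ih =>
    exact .loopTrue (ht 0 n.succ_pos) <| (hp 0 n.succ_pos).seq_singleton <|
      ih (fun i => g (i + 1)) (fun i hi => ht (i + 1) (by omega)) hn
        (fun i hi => hp (i + 1) (by omega)) hP

/-- Run `p x` for the elements `x` of a list, in order. -/
def forEach {ι : Type*} (l : List ι) (p : ι → Prog F O A) : Prog F O A :=
  l.foldr (fun x q => .seq (p x) q) .skip

theorem Exec.forEach {ι : Type*} {l : List ι} {p : ι → Prog F O A} (g : List ι → F × S)
    (h : ∀ l₁ x l₂, l = l₁ ++ x :: l₂ → Exec d P (p x) (g l₁) {g (l₁ ++ [x])})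
    (hP : P (g l).2) : Exec d P (forEach l p) (g []) {g l} := by
  induction l generalizing g with
  | nil => exact .skip hP
  | cons x l ih =>
    refine (h [] x l rfl).seq_singleton (ih (fun l' => g (x :: l')) ?_ hP)
    rintro l₁ y l₂ rfl
    exact h (x :: l₁) y l₂ rfl

section Simulation

variable {X : Type*} {step : X → X → Prop} {acc : X → Prop} {R : X → F × S → Prop}

theorem Reach.loop_cases (hR : ∀ x r, R x r → (t r.1 (d.obs r.2) ↔ ¬ acc x))
    (sound : ∀ x r r', R x r → ¬ acc x → Reach d (p, r) (Prog.skip, r') →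
      ∃ x', step x x' ∧ R x' r')
    {x : X} (hx : R x s) {y : Prog F O A × F × S} (hy : Reach d (.loop t p, s) y) :
    ∃ x' r, Relation.ReflTransGen step x x' ∧ R x' r ∧
      (y = (.loop t p, r) ∨ y = (Prog.skip, r) ∧ acc x' ∨
        ¬ acc x' ∧ ∃ p', y.1 = .seq p' (.loop t p) ∧ Reach d (p, r) (p', y.2)) := by
  induction hy with
  | refl => exact ⟨x, s, .refl, hx, Or.inl rfl⟩
  | @tail y z _ hz ih =>
    obtain ⟨x', r, hx', hr, rfl | ⟨rfl, -⟩ | ⟨hacc, p', hy, hp⟩⟩ := ih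
    · by_cases hacc : acc x'
      · obtain rfl := (step_loop_iff_of_false fun h => (hR _ _ hr).1 h hacc).1 hz
        exact ⟨x', r, hx', hr, Or.inr (Or.inl ⟨rfl, hacc⟩)⟩
      · obtain rfl := (step_loop_iff_of_true ((hR _ _ hr).2 hacc)).1 hz
        exact ⟨x', r, hx', hr, Or.inr (Or.inr ⟨hacc, p, rfl, .refl⟩)⟩
    · exact absurd hz (not_step_skip _ _)
    · obtain ⟨_, sy⟩ := y
      subst hy
      rcases hz.of_seq with ⟨rfl, rfl⟩ | ⟨p'', hz', h⟩
      · obtain ⟨x'', hs, hr'⟩ := sound x' r sy hr hacc hp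
        exact ⟨x'', sy, hx'.tail hs, hr', Or.inl rfl⟩
      · exact ⟨x', r, hx', hr, Or.inr (Or.inr ⟨hacc, p'', hz', hp.tail h⟩)⟩

theorem exists_reach_loop_of_reflTransGen (hR : ∀ x r, R x r → (t r.1 (d.obs r.2) ↔ ¬ acc x))
    (complete : ∀ x r x', R x r → ¬ acc x → step x x' →
      ∃ r', Reach d (p, r) (skip, r') ∧ R x' r')
    {x x' : X} (hx : R x s) (h : Relation.ReflTransGen step x x') (hacc : acc x') :
    ∃ s', Reach d (loop t p, s) (skip, s') := by
  induction h using Relation.ReflTransGen.head_induction_on generalizing s with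
  | refl => exact ⟨s, .single ((step_loop_iff_of_false fun h => (hR _ _ hx).1 h hacc).2 rfl)⟩
  | @head y z hyz _ ih =>
    by_cases hy : acc y
    · exact ⟨s, .single ((step_loop_iff_of_false fun h => (hR _ _ hx).1 h hy).2 rfl)⟩
    · obtain ⟨r, hr, hz⟩ := complete y s z hx hy hyz
      obtain ⟨s', hs'⟩ := ih hz
      exact ⟨s', .head ((step_loop_iff_of_true ((hR _ _ hx).2 hy)).2 rfl) (hr.seq_trans hs')⟩

/-- A loop simulates a transition system if its body simulates single steps; the invariant `R`
relates the states of the system to those of the program between two iterations. -/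
theorem Exec.exists_loop_nonempty_iff (hP : ∀ x r, R x r → P r.2)
    (hR : ∀ x r, R x r → (t r.1 (d.obs r.2) ↔ ¬ acc x))
    (body : ∀ x r, R x r → ¬ acc x → ∃ T, Exec d P p r T ∧
      (∀ r' ∈ T, ∃ x', step x x' ∧ R x' r') ∧ ∀ x', step x x' → ∃ r' ∈ T, R x' r')
    {x : X} (hx : R x s) :
    ∃ T, Exec d P (.loop t p) s T ∧
      (T.Nonempty ↔ ∃ x', Relation.ReflTransGen step x x' ∧ acc x') := by
  have sound : ∀ x r r', R x r → ¬ acc x → Reach d (p, r) (Prog.skip, r') →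
      ∃ x', step x x' ∧ R x' r' := fun x r r' hr hacc h =>
    have ⟨_, hT, hsound, _⟩ := body x r hr hacc
    hsound r' ((hT.outcome r').1 h)
  have complete : ∀ x r x', R x r → ¬ acc x → step x x' →
      ∃ r', Reach d (p, r) (Prog.skip, r') ∧ R x' r' := fun x r x' hr hacc h =>
    have ⟨_, hT, _, hcomplete⟩ := body x r hr hacc
    have ⟨r', hr', hx'⟩ := hcomplete x' h
    ⟨r', (hT.outcome r').2 hr', hx'⟩
  refine ⟨{s' | Reach d (.loop t p, s) (Prog.skip, s')}, ⟨fun y hy => ?_, fun s' => Iff.rfl⟩,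
    ?_, fun ⟨x', h, hacc⟩ => exists_reach_loop_of_reflTransGen hR complete hx h hacc⟩
  · obtain ⟨x', r, -, hr, rfl | ⟨rfl, -⟩ | ⟨hacc, p', -, h⟩⟩ := Reach.loop_cases hR sound hx hy
    · exact hP x' r hr
    · exact hP x' r hr
    · obtain ⟨T, hT, -⟩ := body x' r hr hacc
      exact hT.safe (p', y.2) h
  · rintro ⟨s', hs'⟩
    obtain ⟨x', r, h, -, h' | ⟨-, hacc⟩ | ⟨-, p', h', -⟩⟩ := Reach.loop_cases hR sound hx hs'
    · cases h'
    · exact ⟨x', h, hacc⟩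
    · cases h'

end Simulation

/-- A program is deterministic if all its basic steps are. -/
def Det : Prog F O A → Prop
  | skip => True
  | act f => ∀ m o, (f m o).Subsingleton
  | seq p q => p.Det ∧ q.Det
  | ite _ p q => p.Det ∧ q.Det
  | loop _ p => p.Det

theorem det_forEach {ι : Type*} {l : List ι} {p : ι → Prog F O A} (h : ∀ x, (p x).Det) :
    (forEach l p).Det := by
  induction l with
  | nil => trivial
  | cons x l ih => exact ⟨h x, ih⟩

theorem Next.unique {m : F} {o : O} {p₁ p₂ : Prog F O A} {m₁ m₂ : F} {a₁ a₂ : Option A}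
    (hp : p.Det) (h₁ : Next p m o p₁ m₁ a₁) (h₂ : Next p m o p₂ m₂ a₂) :
    p₁ = p₂ ∧ m₁ = m₂ ∧ a₁ = a₂ := by
  induction h₁ generalizing p₂ with
  | act h =>
    cases h₂ with
    | act h' => exact ⟨rfl, Prod.mk.inj (hp _ _ h h')⟩
  | seqSkip =>
    cases h₂ with
    | seqSkip => exact ⟨rfl, rfl, rfl⟩
    | seq h => cases h
  | seq h ih =>
    cases h₂ with
    | seqSkip => cases h
    | seq h' =>
      obtain ⟨rfl, h⟩ := ih hp.1 h'
      exact ⟨rfl, h⟩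
  | iteTrue h =>
    cases h₂ with
    | iteTrue => exact ⟨rfl, rfl, rfl⟩
    | iteFalse h' => exact absurd h h'
  | iteFalse h =>
    cases h₂ with
    | iteTrue h' => exact absurd h' h
    | iteFalse => exact ⟨rfl, rfl, rfl⟩
  | loopTrue h =>
    cases h₂ with
    | loopTrue => exact ⟨rfl, rfl, rfl⟩
    | loopFalse h' => exact absurd h h'
  | loopFalse h =>
    cases h₂ with
    | loopTrue h' => exact absurd h' h
    | loopFalse => exact ⟨rfl, rfl, rfl⟩

/-- The programs that can remain to be executed in the course of an execution. -/
def residuals : Prog F O A → Set (Prog F O A)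
  | skip => {skip}
  | act f => {act f, skip}
  | seq p q => (fun p' => seq p' q) '' residuals p ∪ residuals q
  | ite t p q => {ite t p q} ∪ (residuals p ∪ residuals q)
  | loop t p => {loop t p, skip} ∪ (fun p' => seq p' (loop t p)) '' residuals p

theorem finite_residuals (p : Prog F O A) : p.residuals.Finite := by
  induction p with
  | skip => exact Set.finite_singleton _
  | act f => exact (Set.finite_singleton _).insert _
  | seq p q ihp ihq => exact (ihp.image _).union ihq
  | ite t p q ihp ihq => exact (Set.finite_singleton _).union (ihp.union ihq)
  | loop t p ih => exact (Set.toFinite _).union (ih.image _)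

theorem mem_residuals_self (p : Prog F O A) : p ∈ p.residuals := by
  cases p with
  | skip => exact rfl
  | act f => exact Or.inl rfl
  | seq p q => exact Or.inl ⟨p, mem_residuals_self p, rfl⟩
  | ite t p q => exact Or.inl rfl
  | loop t p => exact Or.inl (Or.inl rfl)

theorem Next.mem_residuals {p₀ p' : Prog F O A} {m m' : F} {o : O} {a : Option A}
    (h : Next p m o p' m' a) (hp : p ∈ p₀.residuals) : p' ∈ p₀.residuals := by
  induction p₀ generalizing p p' with
  | skip => cases hp; cases h
  | act f =>
    rcases hp with rfl | rfl
    · cases h; exact Or.inr rfl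
    · cases h
  | seq p₀ q₀ ihp ihq =>
    rcases hp with ⟨p, hp, rfl⟩ | hp
    · cases h with
      | seqSkip => exact Or.inr (mem_residuals_self _)
      | seq h => exact Or.inl ⟨_, ihp h hp, rfl⟩
    · exact Or.inr (ihq h hp)
  | ite t p₀ q₀ ihp ihq =>
    rcases hp with rfl | hp | hp
    · cases h with
      | iteTrue => exact Or.inr (Or.inl (mem_residuals_self _))
      | iteFalse => exact Or.inr (Or.inr (mem_residuals_self _))
    · exact Or.inr (Or.inl (ihp h hp))
    · exact Or.inr (Or.inr (ihq h hp))
  | loop t p₀ ih =>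
    rcases hp with (rfl | rfl) | ⟨p, hp, rfl⟩
    · cases h with
      | loopTrue => exact Or.inr ⟨_, mem_residuals_self _, rfl⟩
      | loopFalse => exact Or.inl (Or.inr rfl)
    · cases h
    · cases h with
      | seqSkip => exact Or.inl (Or.inl rfl)
      | seq h => exact Or.inr ⟨_, ih h hp, rfl⟩

theorem Det.of_mem_residuals (hp : p.Det) (hq : q ∈ p.residuals) : q.Det := by
  induction p generalizing q with
  | skip => cases hq; trivial
  | act f => rcases hq with rfl | rfl; exacts [hp, trivial]
  | seq p₁ p₂ ih₁ ih₂ =>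
    rcases hq with ⟨q, hq, rfl⟩ | hq
    exacts [⟨ih₁ hp.1 hq, hp.2⟩, ih₂ hp.2 hq]
  | ite t p₁ p₂ ih₁ ih₂ =>
    rcases hq with rfl | hq | hq
    exacts [hp, ih₁ hp.1 hq, ih₂ hp.2 hq]
  | loop t p ih =>
    rcases hq with (rfl | rfl) | ⟨q, hq, rfl⟩
    exacts [hp, trivial, ⟨ih hp hq, hp⟩]

/-- The program points of `p`, as a small type, because the states of a machine form a small
type. -/
def Point (p : Prog F O A) : Type :=
  have := p.finite_residuals.to_subtype
  Shrink.{0} p.residuals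

namespace Point

/-- The program that remains to be executed at a program point. -/
noncomputable def prog (x : p.Point) : Prog F O A :=
  have := p.finite_residuals.to_subtype
  ((equivShrink.{0} p.residuals).symm x).1

theorem prog_mem (x : p.Point) : x.prog ∈ p.residuals :=
  have := p.finite_residuals.to_subtype
  ((equivShrink.{0} p.residuals).symm x).2

theorem prog_injective : Function.Injective (prog : p.Point → Prog F O A) :=
  have := p.finite_residuals.to_subtype
  Subtype.val_injective.comp (equivShrink.{0} p.residuals).symm.injective

theorem exists_prog_eq {p' : Prog F O A} (h : p' ∈ p.residuals) : ∃ x : p.Point, x.prog = p' := by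
  have := p.finite_residuals.to_subtype
  exact ⟨equivShrink.{0} p.residuals ⟨p', h⟩, by simp [prog]⟩

instance : Finite p.Point :=
  have := p.finite_residuals.to_subtype
  Finite.of_equiv _ (equivShrink.{0} p.residuals)

/-- The program point at the start of the program. -/
noncomputable def start (p : Prog F O A) : p.Point :=
  (exists_prog_eq p.mem_residuals_self).choose

theorem prog_start (p : Prog F O A) : (start p).prog = p :=
  (exists_prog_eq p.mem_residuals_self).choose_spec

end Point

section View

variable {X : Type*} {step : X → X → Prop} {view : X → Prog F O A × F × S}

theorem reach_view (sound : ∀ x y, step x y → view x = view y ∨ Step d (view x) (view y))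
    {x y : X} (h : Relation.ReflTransGen step x y) : Reach d (view x) (view y) := by
  induction h with
  | refl => exact .refl
  | tail _ h ih =>
    rcases sound _ _ h with h | h
    · rwa [← h]
    · exact ih.tail h

theorem exists_reflTransGen_of_reach_view
    (complete : ∀ x z, Step d (view x) z → ∃ y, view y = z ∧ step x y)
    {x : X} {z : Prog F O A × F × S} (h : Reach d (view x) z) :
    ∃ y, view y = z ∧ Relation.ReflTransGen step x y := by
  induction h with
  | refl => exact ⟨x, rfl, .refl⟩
  | tail _ h ih =>
    obtain ⟨y, rfl, hy⟩ := ih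
    obtain ⟨y', hy', h⟩ := complete _ _ h
    exact ⟨y', hy', hy.tail h⟩

theorem Exec.exists_view_eq_skip_iff
    (sound : ∀ x y, step x y → view x = view y ∨ Step d (view x) (view y))
    (complete : ∀ x z, Step d (view x) z → ∃ y, view y = z ∧ step x y)
    {x : X} (hx : view x = (p, s)) (h : Exec d P p s T) :
    (∃ y, Relation.ReflTransGen step x y ∧ (view y).1 = Prog.skip) ↔ T.Nonempty := by
  constructor
  · rintro ⟨y, hy, hskip⟩
    have hr := reach_view sound hy
    rw [hx, show view y = (Prog.skip, (view y).2) from Prod.ext hskip rfl] at hr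
    exact ⟨(view y).2, (h.outcome _).1 hr⟩
  · rintro ⟨s', hs'⟩
    have hr := (h.outcome s').2 hs'
    rw [← hx] at hr
    obtain ⟨y, hy, hxy⟩ := exists_reflTransGen_of_reach_view complete hr
    exact ⟨y, hxy, by rw [hy]⟩

end View

end Prog

/-! ### From programs to machines -/

/-- The store of a `k`-pebble automaton: the positions of its head and its pebbles. -/
structure PebbleStore (α : Type*) (k : ℕ) (w : List α) where
  head : Cell w
  pebble : Fin k → Option (Cell w)

/-- What a `k`-pebble automaton sees: the scanned symbol, the pebbles on the scanned cell and the
available pebbles. -/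
abbrev PebbleObs (α : Type*) (k : ℕ) := Symbol α × Finset (Fin k) × Finset (Fin k)

/-- The action `(P, ε)` distributes the available pebbles and those on the scanned cell: those in
`P` are put on the scanned cell, the others are made available. Then the head moves by `ε`. -/
abbrev PebbleAct (k : ℕ) := Finset (Fin k) × Move

/-- The device underlying `k`-pebble automata. -/
def pebbleDevice {α : Type*} (k : ℕ) (w : List α) :
    Device (PebbleObs α k) (PebbleAct k) (PebbleStore α k w) where
  obs s := (scan w s.head, Finset.univ.filter fun i => s.pebble i = some s.head,
    Finset.univ.filter fun i => s.pebble i = none)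
  act a s :=
    { head := Move.onInput a.2 s.head
      pebble := fun i => if s.pebble i = some s.head ∨ s.pebble i = none then
        (if i ∈ a.1 then some s.head else none) else s.pebble i }

namespace Prog

/-- The value `(D, K, ε)` of the transition function of a pebble automaton that has the effect of
an optional action, when `B` is the set of pebbles on the scanned cell and `C` that of available
pebbles. -/
def pebbleOutput {k : ℕ} (B C : Finset (Fin k)) :
    Option (PebbleAct k) → Finset (Fin k) × Finset (Fin k) × Move
  | none => (B, C, Move.stay)
  | some a => ((B ∪ C) ∩ a.1, (B ∪ C) \ a.1, a.2)

theorem pebbleOutput_preserved {k : ℕ} {B C : Finset (Fin k)} (h : Disjoint B C)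
    (a : Option (PebbleAct k)) :
    (pebbleOutput B C a).1 ∪ (pebbleOutput B C a).2.1 = B ∪ C ∧
      Disjoint (pebbleOutput B C a).1 (pebbleOutput B C a).2.1 := by
  cases a with
  | none => exact ⟨rfl, h⟩
  | some a =>
    refine ⟨?_, (Finset.disjoint_sdiff_inter _ _).symm⟩
    rw [Finset.union_comm]
    exact Finset.sdiff_union_inter _ _

/-- The pebble automaton that executes `p` with initial memory `m₀`. It accepts when the program
terminates; where the program cannot go on, it repeats its configuration forever, since the
transition function of a deterministic automaton is total. -/
noncomputable def toPebble {α : Type*} {k : ℕ} {F : Type} [Finite F]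
    (p : Prog F (PebbleObs α k) (PebbleAct k)) (m₀ : F) : PebbleAutomaton α k where
  Q := p.Point × F
  finite_Q := inferInstance
  start := (Point.start p, m₀)
  accept := {x | x.1.prog = skip}
  δ x a B C := {r | (∃ y, Next x.1.prog x.2 (a, B, C) r.1.1.prog r.1.2 y ∧
      r.2 = pebbleOutput B C y) ∨
    ((∀ p' m' y, ¬ Next x.1.prog x.2 (a, B, C) p' m' y) ∧ r = (x, B, C, Move.stay))}
  pebbles_preserved := by
    rintro x a B C h p D K ε (⟨y, -, hy⟩ | ⟨-, hy⟩)
    · have := pebbleOutput_preserved h y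
      rw [← hy] at this
      exact this
    · cases hy
      exact ⟨rfl, h⟩

section Pebble

variable {α : Type*} {k : ℕ} {F : Type} [Finite F]
  {p : Prog F (PebbleObs α k) (PebbleAct k)} {m₀ : F}

theorem toPebble_isDeterministic (hp : p.Det) : (p.toPebble m₀).IsDeterministic := by
  intro x a B C
  by_cases h : ∃ p' m' y, Next x.1.prog x.2 (a, B, C) p' m' y
  · obtain ⟨p', m', y, h⟩ := h
    obtain ⟨x', rfl⟩ := Point.exists_prog_eq (h.mem_residuals x.1.prog_mem)
    refine ⟨((x', m'), pebbleOutput B C y), Or.inl ⟨y, h, rfl⟩, ?_⟩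
    rintro ⟨⟨x'', m''⟩, r⟩ (⟨y', h', hr⟩ | ⟨h', -⟩)
    · obtain ⟨h₁, h₂, h₃⟩ := Next.unique (hp.of_mem_residuals x.1.prog_mem) h' h
      dsimp only at h₁ h₂ h₃ hr
      rw [Point.prog_injective h₁, h₂, hr, h₃]
    · exact absurd h (h' _ _ _)
  · push Not at h
    refine ⟨(x, B, C, Move.stay), Or.inr ⟨h, rfl⟩, ?_⟩
    rintro r (⟨y, h', -⟩ | ⟨-, h'⟩)
    · exact absurd h' (h _ _ _)
    · exact h'

variable {w : List α}

/-- The state of the program `p` in a configuration of `p.toPebble m₀`. -/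
noncomputable def pebbleView (c : (p.toPebble m₀).Cfg w) :
    Prog F (PebbleObs α k) (PebbleAct k) × F × PebbleStore α k w :=
  (c.state.1.prog, c.state.2, ⟨c.head, c.pebble⟩)

theorem pebble_run_eq_iff (c c' : (p.toPebble m₀).Cfg w) (y : Option (PebbleAct k)) :
    (⟨c'.head, c'.pebble⟩ : PebbleStore α k w) =
      (pebbleDevice k w).run y ⟨c.head, c.pebble⟩ ↔
    c'.head = Move.onInput (pebbleOutput c.here c.available y).2.2 c.head ∧
      ∀ i, c'.pebble i = if i ∈ (pebbleOutput c.here c.available y).1 then some c.head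
        else if i ∈ (pebbleOutput c.here c.available y).2.1 then none else c.pebble i := by
  cases y with
  | none =>
    simp only [pebbleOutput, Device.run, PebbleStore.mk.injEq, Move.onInput, funext_iff,
      PebbleAutomaton.Cfg.here, PebbleAutomaton.Cfg.available, Finset.mem_filter,
      Finset.mem_univ, true_and]
    refine and_congr_right fun _ => forall_congr' fun i => ?_
    split_ifs with h₁ h₂
    exacts [by rw [h₁], by rw [h₂], Iff.rfl]
  | some a =>
    simp only [pebbleOutput, Device.run, PebbleStore.mk.injEq, funext_iff, pebbleDevice,
      PebbleAutomaton.Cfg.here, PebbleAutomaton.Cfg.available, Finset.mem_filter,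
      Finset.mem_univ, true_and, Finset.mem_inter, Finset.mem_union, Finset.mem_sdiff]
    refine and_congr_right fun _ => forall_congr' fun i => ?_
    by_cases h : c.pebble i = some c.head ∨ c.pebble i = none <;> by_cases hi : i ∈ a.1 <;>
      simp only [h, hi, and_true, and_false, if_true, if_false, not_true, not_false_eq_true]

theorem pebbleView_sound (c c' : (p.toPebble m₀).Cfg w) (h : (p.toPebble m₀).Step w c c') :
    pebbleView c = pebbleView c' ∨ Step (pebbleDevice k w) (pebbleView c) (pebbleView c') := by
  obtain ⟨q, D, K, ε, ⟨y, hn, hy⟩ | ⟨-, hy⟩, rfl, hhead, hpebble⟩ := h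
  · refine Or.inr ⟨y, hn, (pebble_run_eq_iff c c' y).2 ?_⟩
    rw [← show (D, K, ε) = pebbleOutput c.here c.available y from hy]
    exact ⟨hhead, hpebble⟩
  · obtain ⟨hq, hout⟩ : c'.state = c.state ∧ (D, K, ε) = pebbleOutput c.here c.available none :=
      Prod.mk.inj hy
    cases hout
    have hstore := (pebble_run_eq_iff c c' none).2 ⟨hhead, hpebble⟩
    exact Or.inl (by rw [pebbleView, pebbleView, hq, hstore, Device.run])

theorem pebbleView_complete (c : (p.toPebble m₀).Cfg w)
    (z : Prog F (PebbleObs α k) (PebbleAct k) × F × PebbleStore α k w)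
    (h : Step (pebbleDevice k w) (pebbleView c) z) :
    ∃ c', pebbleView c' = z ∧ (p.toPebble m₀).Step w c c' := by
  obtain ⟨p', m', s'⟩ := z
  obtain ⟨y, hn, hy⟩ := h
  obtain ⟨x', rfl⟩ := Point.exists_prog_eq (hn.mem_residuals c.state.1.prog_mem)
  refine ⟨⟨(x', m'), s'.head, s'.pebble⟩, rfl, ?_⟩
  have hstore := (pebble_run_eq_iff c ⟨(x', m'), s'.head, s'.pebble⟩ y).1 hy
  exact ⟨(x', m'), _, _, _, Or.inl ⟨y, hn, rfl⟩, rfl, hstore⟩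

theorem mem_language_toPebble {P : PebbleStore α k w → Prop} {T : Set (F × PebbleStore α k w)}
    (h : Exec (pebbleDevice k w) P p (m₀, ⟨0, fun _ => none⟩) T) :
    w ∈ (p.toPebble m₀).language ↔ T.Nonempty :=
  h.exists_view_eq_skip_iff pebbleView_sound pebbleView_complete
    (x := (p.toPebble m₀).init w) (Prod.ext (Point.prog_start p) rfl)

end Pebble

end Prog

/-- The store of a Turing machine with one work tape. -/
@[ext]
structure TapeStore (α Γ : Type*) (w : List α) where
  head : Cell w
  pos : ℕ
  tape : ℕ → Γ

/-- The device underlying Turing machines with one work tape. The action `(g, ε, η)` writes `g`,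
moves the input head by `ε` and the work head by `η`. -/
def tapeDevice {α : Type*} (Γ : Type*) (w : List α) :
    Device (Symbol α × Γ) (Γ × Move × Move) (TapeStore α Γ w) where
  obs s := (scan w s.head, s.tape s.pos)
  act a s :=
    { head := Move.onInput a.2.1 s.head
      pos := Move.onWork a.2.2 s.pos
      tape := Function.update s.tape s.pos a.1 }

namespace Prog

/-- The action that has the effect of an optional action when `g` is scanned. -/
def tapeOutput {Γ : Type*} (g : Γ) : Option (Γ × Move × Move) → Γ × Move × Move
  | none => (g, Move.stay, Move.stay)
  | some a => a

section Turing

variable {α : Type*} {Γ F : Type} [Finite Γ] [Finite F]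

/-- The Turing machine that executes `p` with initial memory `m₀`. It accepts when the program
terminates. -/
noncomputable def toTuring (p : Prog F (Symbol α × Γ) (Γ × Move × Move)) (blank : Γ) (m₀ : F) :
    TuringMachine α 1 where
  Q := p.Point × F
  finite_Q := inferInstance
  Γ := Γ
  finite_Γ := inferInstance
  blank := blank
  start := (Point.start p, m₀)
  accept := {x | x.1.prog = skip}
  δ x a f := {r | ∃ y, Next x.1.prog x.2 (a, f 0) r.1.1.prog r.1.2 y ∧
    r.2 = (fun _ => (tapeOutput (f 0) y).1, (tapeOutput (f 0) y).2.1,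
      fun _ => (tapeOutput (f 0) y).2.2)}

variable {p : Prog F (Symbol α × Γ) (Γ × Move × Move)} {blank : Γ} {m₀ : F}

theorem toTuring_isDeterministic (hp : p.Det) : (p.toTuring blank m₀).IsDeterministic := by
  rintro x a f ⟨⟨q₁, m₁⟩, r₁⟩ ⟨y₁, h₁, e₁⟩ ⟨⟨q₂, m₂⟩, r₂⟩ ⟨y₂, h₂, e₂⟩
  obtain ⟨hq, hm, hy⟩ := Next.unique (hp.of_mem_residuals x.1.prog_mem) h₁ h₂
  dsimp only at hq hm e₁ e₂
  rw [Point.prog_injective hq, hm, e₁, e₂, hy]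

variable {w : List α}

/-- The state of the program `p` in a configuration of `p.toTuring blank m₀`. -/
noncomputable def turingView (c : (p.toTuring blank m₀).Cfg w) :
    Prog F (Symbol α × Γ) (Γ × Move × Move) × F × TapeStore α Γ w :=
  (c.state.1.prog, c.state.2, ⟨c.head, c.workHead 0, c.tape 0⟩)

theorem turing_run_eq_iff (c c' : (p.toTuring blank m₀).Cfg w) (y : Option (Γ × Move × Move)) :
    (⟨c'.head, c'.workHead 0, c'.tape 0⟩ : TapeStore α Γ w) =
      (tapeDevice Γ w).run y ⟨c.head, c.workHead 0, c.tape 0⟩ ↔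
    c'.head = Move.onInput (tapeOutput (c.tape 0 (c.workHead 0)) y).2.1 c.head ∧
      (∀ j, c'.workHead j =
        Move.onWork (tapeOutput (c.tape 0 (c.workHead 0)) y).2.2 (c.workHead j)) ∧
      ∀ j, c'.tape j = Function.update (c.tape j) (c.workHead j)
        (tapeOutput (c.tape 0 (c.workHead 0)) y).1 := by
  cases y with
  | none =>
    simp only [tapeOutput, Device.run, Move.onInput, Move.onWork, Fin.forall_fin_one,
      Function.update_eq_self]
    exact TapeStore.ext_iff
  | some a =>
    simp only [tapeOutput, Device.run, tapeDevice, Fin.forall_fin_one]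
    exact TapeStore.ext_iff

theorem turingView_sound (c c' : (p.toTuring blank m₀).Cfg w)
    (h : (p.toTuring blank m₀).Step w c c') :
    turingView c = turingView c' ∨ Step (tapeDevice Γ w) (turingView c) (turingView c') := by
  obtain ⟨q, g, ε, η, ⟨y, hn, hy⟩, rfl, h⟩ := h
  dsimp only at hy
  cases hy
  exact Or.inr ⟨y, hn, (turing_run_eq_iff c c' y).2 h⟩

theorem turingView_complete (c : (p.toTuring blank m₀).Cfg w)
    (z : Prog F (Symbol α × Γ) (Γ × Move × Move) × F × TapeStore α Γ w)
    (h : Step (tapeDevice Γ w) (turingView c) z) :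
    ∃ c', turingView c' = z ∧ (p.toTuring blank m₀).Step w c c' := by
  obtain ⟨p', m', s'⟩ := z
  obtain ⟨y, hn, hy⟩ := h
  obtain ⟨x', rfl⟩ := Point.exists_prog_eq (hn.mem_residuals c.state.1.prog_mem)
  refine ⟨⟨(x', m'), s'.head, fun _ => s'.pos, fun _ => s'.tape⟩, rfl, ?_⟩
  exact ⟨(x', m'), _, _, _, ⟨y, hn, rfl⟩, rfl,
    (turing_run_eq_iff c ⟨(x', m'), s'.head, fun _ => s'.pos, fun _ => s'.tape⟩ y).1 hy⟩

theorem turingView_init : turingView ((p.toTuring blank m₀).init w) =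
    (p, m₀, ⟨0, 0, fun _ => blank⟩) :=
  Prod.ext (Point.prog_start p) rfl

theorem mem_language_toTuring {P : TapeStore α Γ w → Prop} {T : Set (F × TapeStore α Γ w)}
    (h : Exec (tapeDevice Γ w) P p (m₀, ⟨0, 0, fun _ => blank⟩) T) :
    w ∈ (p.toTuring blank m₀).language ↔ T.Nonempty :=
  h.exists_view_eq_skip_iff turingView_sound turingView_complete turingView_init

theorem toTuring_spaceBound {b : ℕ → ℕ}
    (h : ∀ w : List α, ∃ T, Exec (tapeDevice Γ w) (fun s => s.pos < b w.length) p
      (m₀, ⟨0, 0, fun _ => blank⟩) T) : (p.toTuring blank m₀).SpaceBound b := by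
  intro w c hc j
  obtain ⟨T, hT⟩ := h w
  have hview := reach_view (d := tapeDevice Γ w) turingView_sound hc
  rw [turingView_init] at hview
  rw [Subsingleton.elim j 0]
  exact hT.safe (turingView c) hview

end Turing

end Prog

/-! ### Head movements -/

namespace Move

instance : Finite Move :=
  Finite.of_surjective ![left, stay, right] fun ε => by
    cases ε
    exacts [⟨0, rfl⟩, ⟨1, rfl⟩, ⟨2, rfl⟩]

/-- The displacement of the head. -/
def toInt : Move → ℤ
  | left => -1
  | stay => 0
  | right => 1

/-- The movement of the head on the input tape that results from a move off a cell with symbol `a`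
in a given direction, the endmarkers being taken into account. -/
def effective {α : Type*} : Move → Symbol α → Move
  | left, .leftEnd => stay
  | right, .rightEnd => stay
  | ε, _ => ε

end Move

theorem scan_eq_leftEnd_iff {α : Type*} {w : List α} {i : Cell w} :
    scan w i = .leftEnd ↔ i.val = 0 := by
  unfold scan
  split_ifs with h
  · simp only [h]
  · split <;> simp only [h, reduceCtorEq]

theorem scan_eq_rightEnd_iff {α : Type*} {w : List α} {i : Cell w} :
    scan w i = .rightEnd ↔ i.val = w.length + 1 := by
  have := i.isLt
  unfold scan
  split_ifs with h
  · simp only [h, reduceCtorEq]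
  · split
    next a ha =>
      have := (List.getElem?_eq_some_iff.1 ha).1
      simp only [reduceCtorEq, false_iff]
      omega
    next ha =>
      have := List.getElem?_eq_none_iff.1 ha
      simp only [true_iff]
      omega

theorem Move.onInput_val {α : Type*} {w : List α} (ε : Move) (i : Cell w) :
    ((ε.onInput i).val : ℤ) = i.val + (ε.effective (scan w i)).toInt := by
  have := i.isLt
  cases ε with
  | stay => simp only [onInput, effective, toInt, add_zero]
  | left =>
    have h := scan_eq_leftEnd_iff (w := w) (i := i)
    cases hs : scan w i <;> simp only [hs, reduceCtorEq, true_iff, false_iff] at h <;>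
      simp only [onInput, effective, toInt] <;> omega
  | right =>
    have h := scan_eq_rightEnd_iff (w := w) (i := i)
    cases hs : scan w i <;> simp only [hs, reduceCtorEq, true_iff, false_iff] at h <;>
      simp only [onInput, effective, toInt] <;> omega

/-! ### Programs that traverse a list on the work tape -/

section ListTape

variable {β : Type*}

/-- The tape that holds a list from cell `1` on. Cell `0` is blank, so that the head can find the
beginning of the list. -/
def listTape (l : List β) : ℕ → Option β
  | 0 => none
  | i + 1 => l[i]?

theorem listTape_nil : listTape ([] : List β) = fun _ => none := by
  funext i
  cases i <;> rfl

theorem listTape_length (l : List β) : listTape l (l.length + 1) = none :=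
  List.getElem?_eq_none le_rfl

theorem listTape_append_cons (d : List β) (c : β) (r : List β) :
    listTape (d ++ c :: r) (d.length + 1) = some c := by
  simp only [listTape, le_refl, List.getElem?_append_right, Nat.sub_self, List.getElem?_cons_zero]

theorem update_listTape_append_cons (d : List β) (c c' : β) (r : List β) :
    Function.update (listTape (d ++ c :: r)) (d.length + 1) (some c') =
      listTape (d ++ c' :: r) := by
  funext i
  cases i with
  | zero => rfl
  | succ i =>
    simp only [Function.update_apply, listTape, List.getElem?_append, List.getElem?_cons]
    grind

theorem update_listTape_length (l : List β) (c : β) :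
    Function.update (listTape l) (l.length + 1) (some c) = listTape (l ++ [c]) := by
  funext i
  cases i with
  | zero => rfl
  | succ i =>
    simp only [Function.update_apply, listTape, List.getElem?_append, List.getElem?_cons]
    grind

end ListTape

namespace Prog

variable {α β F : Type*} {w : List α} {N : ℕ}

/-- Programs for a Turing machine whose work tape holds a list. -/
abbrev ListProg (α F β : Type*) :=
  Prog F (Symbol α × Option β) (Option β × Move × Move)

/-- Execution of a program by a Turing machine that visits only the first `N` cells of its work
tape. -/
abbrev ExecBelow (N : ℕ) (p : ListProg α F β) (s : F × TapeStore α (Option β) w)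
    (T : Set (F × TapeStore α (Option β) w)) : Prop :=
  Exec (tapeDevice (Option β) w) (fun s => s.pos < N) p s T

theorem ExecBelow.act_singleton {p : F → Symbol α × Option β → Set (F × Option (_ × Move × Move))}
    {f f' : F} {s : TapeStore α (Option β) w} {c : Option β} {ε η : Move}
    (hp : p f (scan w s.head, s.tape s.pos) = {(f', some (c, ε, η))}) (hs : s.pos < N)
    (hs' : η.onWork s.pos < N) :
    ExecBelow N (.act p) (f, s)
      {(f', ⟨ε.onInput s.head, η.onWork s.pos, Function.update s.tape s.pos c⟩)} :=
  Exec.act_of_eq_singleton (d := tapeDevice (Option β) w) (P := fun s => s.pos < N)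
    (a := some (c, ε, η)) hp hs hs'

/-- Move the work head. -/
def moveWork (η : Move) : ListProg α F β :=
  .act fun f o => {(f, some (o.2, .stay, η))}

theorem det_moveWork (η : Move) : (moveWork η : ListProg α F β).Det :=
  fun _ _ => Set.subsingleton_singleton

theorem exec_moveWork (η : Move) (f : F) (s : TapeStore α (Option β) w) (hs : s.pos < N)
    (hs' : η.onWork s.pos < N) :
    ExecBelow N (moveWork η) (f, s) {(f, ⟨s.head, η.onWork s.pos, s.tape⟩)} := by
  have hexec : ExecBelow N (moveWork η) (f, s) _ := .act_singleton rfl hs hs'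
  rwa [Function.update_eq_self] at hexec

/-- Replace the memory and the entries of the list from the work head on by means of `u`, from left
to right. -/
def sweep (u : F → β → F × β) : ListProg α F β :=
  .loop (fun _ o => o.2 ≠ none) (.act fun f o => match o.2 with
    | some c => {((u f c).1, some (some (u f c).2, .stay, .right))}
    | none => ∅)

theorem det_sweep (u : F → β → F × β) : (sweep u : ListProg α F β).Det := by
  rintro f ⟨a, _ | c⟩
  exacts [Set.subsingleton_empty, Set.subsingleton_singleton]

/-- The effect of `sweep` on the memory and the list. -/
def sweepResult (u : F → β → F × β) : F → List β → F × List β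
  | f, [] => (f, [])
  | f, c :: l => ((sweepResult u (u f c).1 l).1, (u f c).2 :: (sweepResult u (u f c).1 l).2)

theorem exec_sweep (u : F → β → F × β) (f : F) (h : Cell w) (d r : List β)
    (hN : (d ++ r).length + 1 < N) :
    ExecBelow N (sweep u) (f, ⟨h, d.length + 1, listTape (d ++ r)⟩)
      {((sweepResult u f r).1,
        ⟨h, (d ++ r).length + 1, listTape (d ++ (sweepResult u f r).2)⟩)} := by
  induction r generalizing d f with
  | nil =>
    simp only [sweepResult, List.append_nil] at hN ⊢
    exact .loopFalse hN (not_not.2 (listTape_length d))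
  | cons c r ih =>
    have hd : d.length + 2 < N := by
      simp only [List.length_append, List.length_cons] at hN
      omega
    have hread := listTape_append_cons d c r
    refine .loopTrue (fun hnone => Option.some_ne_none c (hread.symm.trans hnone)) ?_
    refine (ExecBelow.act_singleton (f' := (u f c).1) (c := some (u f c).2) (ε := .stay)
      (η := .right) (by simp only [hread]) (Nat.lt_of_succ_lt hd) hd).seq_singleton ?_
    simp only [List.append_cons d c r, List.length_append, List.length_singleton] at hN
    have := ih (u f c).1 (d ++ [(u f c).2])
      (by simpa only [List.length_append, List.length_singleton] using hN)
    simpa only [sweep, Move.onInput, Move.onWork, update_listTape_append_cons, sweepResult,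
      List.append_assoc, List.singleton_append,
      List.length_append, List.length_cons, List.length_nil, Nat.zero_add] using this

/-- Move the work head back from behind the list to its first entry. -/
def rewind : ListProg α F β :=
  .seq (moveWork .left) (.seq (.loop (fun _ o => o.2 ≠ none) (moveWork .left)) (moveWork .right))

theorem det_rewind : (rewind : ListProg α F β).Det :=
  ⟨det_moveWork _, det_moveWork _, det_moveWork _⟩

theorem exec_rewind (f : F) (h : Cell w) (l : List β) (hN : l.length + 1 < N) :
    ExecBelow N rewind (f, ⟨h, l.length + 1, listTape l⟩)
      {(f, ⟨h, 1, listTape l⟩)} := by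
  have loop := Exec.loop_of_sequence (d := tapeDevice (Option β) w) (P := fun s => s.pos < N)
    (t := fun (_ : F) o => o.2 ≠ none) (p := moveWork .left) l.length
    (fun i => (f, ⟨h, l.length - i, listTape l⟩)) ?_ ?_ ?_ (by dsimp only; omega)
  · rw [Nat.sub_self] at loop
    exact (exec_moveWork _ _ _ hN (Nat.lt_of_succ_lt hN)).seq_singleton <| loop.seq_singleton <|
      exec_moveWork _ _ _ (by dsimp only; omega) (by dsimp only [Move.onWork]; omega)
  · intro i hi
    obtain ⟨k, hk⟩ : ∃ k, l.length - i = k + 1 := ⟨l.length - i - 1, by omega⟩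
    simp only [tapeDevice, hk, listTape, ne_eq, List.getElem?_eq_none_iff]
    omega
  · simp only [tapeDevice, Nat.sub_self, listTape, ne_eq, not_true, not_false_eq_true]
  · intro i hi
    exact exec_moveWork _ _ _ (by dsimp only; omega) (by dsimp only [Move.onWork]; omega)

end Prog

/-! ### Simulation of a pebble automaton by a Turing machine -/

/-- One binary digit of each of several numbers: of the head position, and of the positions of `m`
pebbles. -/
abbrev Col (m : ℕ) := Option (Fin m) → Bool

section Columns

variable {m : ℕ} {x y : Option (Fin m)} {c : Col m} {l : List (Col m)}

/-- The number in row `x` of a list of columns, with the least significant digit first. -/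
def rowVal (x : Option (Fin m)) (l : List (Col m)) : ℕ :=
  Nat.ofDigits 2 (l.map fun c => (c x).toNat)

theorem rowVal_cons : rowVal x (c :: l) = (c x).toNat + 2 * rowVal x l := by
  simp only [rowVal, List.map_cons, Nat.ofDigits_cons]

theorem rowVal_append_singleton :
    rowVal x (l ++ [c]) = rowVal x l + 2 ^ l.length * (c x).toNat := by
  simp only [rowVal, List.map_append, Nat.ofDigits_append, List.length_map, List.map_cons,
    List.map_nil, Nat.ofDigits_singleton]

theorem forall_mem_digits_lt : ∀ d ∈ l.map fun c => (c x).toNat, d < 2 := by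
  intro d hd
  obtain ⟨c, -, rfl⟩ := List.mem_map.1 hd
  exact Bool.toNat_lt _

theorem rowVal_lt : rowVal x l < 2 ^ l.length := by
  simpa only [List.length_map, rowVal] using
    Nat.ofDigits_lt_base_pow_length one_lt_two (forall_mem_digits_lt (x := x) (l := l))

theorem rowVal_eq_iff : rowVal x l = rowVal y l ↔ ∀ c ∈ l, c x = c y := by
  constructor
  · intro h
    have toNat_injective : Function.Injective Bool.toNat := by decide
    have := Nat.ofDigits_inj_of_len_eq one_lt_two (by simp only [List.length_map])
      forall_mem_digits_lt forall_mem_digits_lt h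
    exact fun c hc => toNat_injective (List.map_inj_left.1 this c hc)
  · intro h
    rw [rowVal, List.map_congr_left fun c hc => congrArg Bool.toNat (h c hc), rowVal]

/-- The digit and the carry that result from adding a carry `-1`, `0` or `1` to a binary digit. -/
def addCarry : Bool → Move → Bool × Move
  | b, .stay => (b, .stay)
  | false, .right => (true, .stay)
  | true, .right => (false, .right)
  | true, .left => (false, .stay)
  | false, .left => (true, .left)

theorem addCarry_spec (b : Bool) (ε : Move) :
    ((addCarry b ε).1.toNat : ℤ) + 2 * (addCarry b ε).2.toInt = b.toNat + ε.toInt := by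
  cases b <;> cases ε <;> rfl

/-- Extend a list of columns by the carry that is left over from the row of the head position. -/
def withCarry : Move → List (Col m) → List (Col m)
  | .right, l => l ++ [Option.isNone]
  | _, l => l

theorem rowVal_some_withCarry {ε : Move} {i : Fin m} :
    rowVal (some i) (withCarry ε l) = rowVal (some i) l := by
  cases ε with
  | right => simp only [withCarry, rowVal_append_singleton, Option.isNone_some, Bool.toNat_false,
      mul_zero, add_zero]
  | _ => rfl

section Overflow

variable {ε : Move} {n : ℕ} (h : (n : ℤ) = rowVal none l + 2 ^ l.length * ε.toInt)
include h

theorem rowVal_none_withCarry : rowVal none (withCarry ε l) = n := by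
  have hlt : (rowVal none l : ℤ) < 2 ^ l.length := by exact_mod_cast rowVal_lt
  zify
  cases ε with
  | right =>
    simpa only [withCarry, rowVal_append_singleton, Option.isNone_none, Bool.toNat_true,
      Nat.cast_add, Nat.cast_mul, Nat.cast_pow, Nat.cast_ofNat, Nat.cast_one, Move.toInt] using
      h.symm
  | stay => simpa only [withCarry, Move.toInt, mul_zero, add_zero] using h.symm
  | left =>
    simp only [Move.toInt] at h
    omega

theorem two_pow_length_withCarry_le {N : ℕ} (hn : n ≤ N) (hl : 2 ^ l.length ≤ 2 * N) :
    2 ^ (withCarry ε l).length ≤ 2 * N := by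
  cases ε with
  | right =>
    have : 2 ^ l.length ≤ n := by
      zify
      rw [h, Move.toInt, mul_one]
      omega
    rw [withCarry, List.length_append, List.length_singleton, pow_succ]
    omega
  | _ => exact hl

end Overflow

end Columns

/-- The finite memory for the simulation of a pebble automaton with set of states `Q`: its state and
its set of available pebbles, the pebbles that may be on the scanned cell, those that are to be put
there, and the number that is to be added to the head position. -/
structure HeadMem (Q : Type*) (m : ℕ) where
  state : Q
  avail : Finset (Fin m)
  same : Finset (Fin m)
  drop : Finset (Fin m)
  carry : Move

namespace HeadMem

variable {Q : Type*} {m : ℕ}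

instance [Finite Q] : Finite (HeadMem Q m) :=
  Finite.of_injective (β := Q × Finset (Fin m) × Finset (Fin m) × Finset (Fin m) × Move)
    (fun x => (x.state, x.avail, x.same, x.drop, x.carry)) fun x y h => by
      cases x
      cases y
      simpa only [mk.injEq, Prod.mk.injEq] using h

/-- Compare the digits of the positions of the pebbles with those of the head position. -/
def compare (x : HeadMem Q m) (c : Col m) : HeadMem Q m × Col m :=
  ({ x with same := x.same.filter fun i => c (some i) = c none }, c)

/-- Copy a digit of the head position to the pebbles that are put down, and add the carry to it. -/
def advance (x : HeadMem Q m) (c : Col m) : HeadMem Q m × Col m :=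
  ({ x with carry := (addCarry (c none) x.carry).2 }, fun
    | none => (addCarry (c none) x.carry).1
    | some i => if i ∈ x.drop then c none else c (some i))

/-- The effect of `compare` on the memory. -/
def compared (x : HeadMem Q m) (l : List (Col m)) : HeadMem Q m :=
  { x with same := x.same.filter fun i => rowVal (some i) l = rowVal none l }

theorem sweepResult_compare (x : HeadMem Q m) (l : List (Col m)) :
    Prog.sweepResult compare x l = (x.compared l, l) := by
  simp only [compared, rowVal_eq_iff]
  induction l generalizing x with
  | nil => simp only [Prog.sweepResult, List.not_mem_nil, false_imp_iff, implies_true,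
      Finset.filter_true]
  | cons c l ih =>
    simp only [Prog.sweepResult, compare] at ih ⊢
    simp only [ih, Finset.filter_filter, List.forall_mem_cons]

theorem sweepResult_advance (x : HeadMem Q m) (l : List (Col m)) :
    ∃ ε l', Prog.sweepResult advance x l = ({ x with carry := ε }, l') ∧ l'.length = l.length ∧
      (∀ i, rowVal (some i) l' = if i ∈ x.drop then rowVal none l else rowVal (some i) l) ∧
      (rowVal none l' : ℤ) + 2 ^ l'.length * ε.toInt = rowVal none l + x.carry.toInt := by
  induction l generalizing x with
  | nil => exact ⟨x.carry, [], rfl, rfl, fun i => (ite_self 0).symm, by simp [rowVal]⟩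
  | cons c l ih =>
    obtain ⟨ε, l', h, hlen, hsome, hnone⟩ := ih (advance x c).1
    refine ⟨ε, (advance x c).2 :: l', ?_, congrArg (· + 1) hlen, fun i => ?_, ?_⟩
    · rw [Prog.sweepResult, h]
      rfl
    · rw [rowVal_cons, hsome]
      by_cases hi : i ∈ x.drop <;> simp only [advance, rowVal_cons, hi, if_true, if_false]
    · have hdigit := addCarry_spec (c none) x.carry
      simp only [rowVal_cons, advance, List.length_cons, pow_succ, Nat.cast_add, Nat.cast_mul,
        Nat.cast_ofNat] at hnone ⊢
      linear_combination 2 * hnone + hdigit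

end HeadMem

namespace PebbleAutomaton

open Prog HeadMem

variable {α : Type*} {m : ℕ} (M : PebbleAutomaton α m)

/-- Determine which pebbles have the same position as the head. -/
def comparePebbles : ListProg α (HeadMem M.Q m) (Col m) :=
  .seq (.act fun f _ => {({ f with same := Finset.univ }, none)}) (.seq (sweep compare) rewind)

/-- The memory after a transition `r` has been chosen at a cell with symbol `a`. -/
def chosen (f : HeadMem M.Q m) (a : Symbol α) (r : M.Q × Finset (Fin m) × Finset (Fin m) × Move) :
    HeadMem M.Q m :=
  ⟨r.1, r.2.2.1, f.same, r.2.1, r.2.2.2.effective a⟩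

/-- Perform the part of a transition that does not involve the work tape. -/
def chooseTransition : ListProg α (HeadMem M.Q m) (Col m) :=
  .act fun f o => (fun r => (M.chosen f o.1 r, some (o.2, r.2.2.2, .stay))) ''
    M.δ f.state o.1 (f.same \ f.avail) f.avail

/-- Append a column for the carry. -/
def appendCarry : ListProg α (HeadMem M.Q m) (Col m) :=
  .ite (fun f _ => f.carry = .right)
    (.act fun f _ => {(f, some (some Option.isNone, .stay, .right))}) .skip

/-- Update the positions of the head and of the pebbles that are put down. -/
def updatePositions : ListProg α (HeadMem M.Q m) (Col m) :=
  .seq (sweep advance) (.seq M.appendCarry rewind)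

/-- The simulation of one step. -/
def simulateStep : ListProg α (HeadMem M.Q m) (Col m) :=
  .seq M.comparePebbles (.seq M.chooseTransition M.updatePositions)

/-- The simulation of a pebble automaton. -/
def simulation : ListProg α (HeadMem M.Q m) (Col m) :=
  .seq (moveWork .right) (.loop (fun f _ => f.state ∉ M.accept) M.simulateStep)

theorem det_simulation (hM : M.IsDeterministic) : M.simulation.Det :=
  have det_act_singleton {g : HeadMem M.Q m → _} :
      (Prog.act fun f _ => {g f} : ListProg α (HeadMem M.Q m) (Col m)).Det :=
    fun _ _ => Set.subsingleton_singleton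
  have det_chooseTransition : M.chooseTransition.Det := fun _ _ =>
    Set.Subsingleton.image (fun _ h _ h' => (hM _ _ _ _).unique h h') _
  ⟨det_moveWork _, ⟨det_act_singleton, det_sweep _, det_rewind⟩, det_chooseTransition,
    det_sweep _, ⟨det_act_singleton, trivial⟩, det_rewind⟩

variable {M} {w : List α} {N : ℕ}

theorem exec_comparePebbles (f : HeadMem M.Q m) (h : Cell w) (l : List (Col m))
    (hN : l.length + 1 < N) :
    ExecBelow N M.comparePebbles (f, ⟨h, 1, listTape l⟩)
      {(({ f with same := Finset.univ } : HeadMem M.Q m).compared l, ⟨h, 1, listTape l⟩)} := by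
  have hpos : 1 < N := by omega
  have hsweep := exec_sweep compare { f with same := Finset.univ } h [] l hN
  rw [sweepResult_compare] at hsweep
  exact (Exec.act_of_eq_singleton rfl hpos hpos).seq_singleton
    (hsweep.seq_singleton (exec_rewind _ h l hN))

theorem exec_chooseTransition (f : HeadMem M.Q m) (h : Cell w) (l : List (Col m))
    (hN : 1 < N) :
    ExecBelow N M.chooseTransition (f, ⟨h, 1, listTape l⟩)
      ((fun r => (M.chosen f (scan w h) r, ⟨r.2.2.2.onInput h, 1, listTape l⟩)) ''
        M.δ f.state (scan w h) (f.same \ f.avail) f.avail) := by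
  have hexec : ExecBelow N M.chooseTransition (f, ⟨h, 1, listTape l⟩) _ := Exec.act hN <| by
    rintro _ _ ⟨r, -, hr⟩
    cases hr
    exact hN
  simpa only [Set.image_image, Device.run, tapeDevice, Move.onWork, Function.update_eq_self]
    using hexec

theorem exec_appendCarry (f : HeadMem M.Q m) (h : Cell w) (l : List (Col m))
    (hl : l.length + 1 < N) (hl' : (withCarry f.carry l).length + 1 < N) :
    ExecBelow N M.appendCarry (f, ⟨h, l.length + 1, listTape l⟩)
      {(f, ⟨h, (withCarry f.carry l).length + 1, listTape (withCarry f.carry l)⟩)} := by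
  by_cases hf : f.carry = .right
  · rw [hf, withCarry, List.length_append, List.length_singleton] at hl' ⊢
    rw [← update_listTape_length]
    exact .iteTrue hf (ExecBelow.act_singleton (s := ⟨h, l.length + 1, listTape l⟩)
      (c := some Option.isNone) (ε := .stay) (η := .right) rfl hl hl')
  · rw [show withCarry f.carry l = l by cases h : f.carry <;> first | rfl | exact absurd h hf]
    exact .iteFalse hf (.skip hl)

theorem length_add_one_lt {k n : ℕ} (h : 2 ^ k ≤ 2 * (n + 1)) :
    k + 1 < 4 * (Nat.log 2 n + 1) := by
  have hk := Nat.le_log_of_pow_le one_lt_two h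
  rw [mul_comm, Nat.log_mul_base one_lt_two (by omega)] at hk
  rcases Nat.eq_zero_or_pos n with rfl | hn
  · rw [Nat.log_one_right] at hk
    omega
  · have : Nat.log 2 (n + 1) ≤ Nat.log 2 n + 1 := by
      rw [← Nat.log_mul_base one_lt_two hn.ne']
      exact Nat.log_mono_right (by omega)
    omega

theorem exists_exec_updatePositions (f : HeadMem M.Q m) (h : Cell w) {n : ℕ} {l : List (Col m)}
    (hn : (n : ℤ) = rowVal none l + f.carry.toInt) (hnw : n ≤ w.length + 1)
    (hl : 2 ^ l.length ≤ 2 * (w.length + 1)) :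
    ∃ ε l', ExecBelow (4 * (Nat.log 2 w.length + 1))
        M.updatePositions (f, ⟨h, 1, listTape l⟩) {({ f with carry := ε }, ⟨h, 1, listTape l'⟩)} ∧
      rowVal none l' = n ∧
      (∀ i, rowVal (some i) l' = if i ∈ f.drop then rowVal none l else rowVal (some i) l) ∧
      2 ^ l'.length ≤ 2 * (w.length + 1) := by
  obtain ⟨ε, l₁, hsweep, hlen, hsome, hnone⟩ := sweepResult_advance f l
  rw [← hlen] at hl
  have hcarry := hn.trans hnone.symm
  have hl' := two_pow_length_withCarry_le hcarry hnw hl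
  refine ⟨ε, withCarry ε l₁, ?_, rowVal_none_withCarry hcarry,
    fun i => rowVal_some_withCarry.trans (hsome i), hl'⟩
  have hadvance := exec_sweep advance f h [] l (by
    rw [List.nil_append, ← hlen]
    exact length_add_one_lt hl)
  rw [hsweep, List.nil_append, ← hlen] at hadvance
  exact hadvance.seq_singleton <|
    (exec_appendCarry { f with carry := ε } h l₁ (length_add_one_lt hl)
      (length_add_one_lt hl')).seq_singleton <| exec_rewind _ h _ (length_add_one_lt hl')

theorem disjoint_here_available (x : M.Cfg w) : Disjoint x.here x.available := by
  rw [Finset.disjoint_left]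
  intro i hi hn
  simp only [Cfg.here, Cfg.available, Finset.mem_filter, Finset.mem_univ, true_and] at hi hn
  rw [hi] at hn
  cases hn

/-- The effect of a transition on a configuration. -/
def Cfg.apply (x : M.Cfg w) (r : M.Q × Finset (Fin m) × Finset (Fin m) × Move) : M.Cfg w where
  state := r.1
  head := r.2.2.2.onInput x.head
  pebble i := if i ∈ r.2.1 then some x.head else if i ∈ r.2.2.1 then none else x.pebble i

theorem step_iff (x x' : M.Cfg w) : M.Step w x x' ↔
    ∃ r ∈ M.δ x.state (scan w x.head) x.here x.available, x' = x.apply r := by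
  obtain ⟨q, h, b⟩ := x'
  simp only [Step, Cfg.apply, Prod.exists, Cfg.mk.injEq, funext_iff]

theorem available_apply (x : M.Cfg w) {r : M.Q × Finset (Fin m) × Finset (Fin m) × Move}
    (hr : r ∈ M.δ x.state (scan w x.head) x.here x.available) :
    (x.apply r).available = r.2.2.1 := by
  obtain ⟨p, D, K, ε⟩ := r
  obtain ⟨hunion, hdisjoint⟩ :=
    M.pebbles_preserved _ _ _ _ (disjoint_here_available x) p D K ε hr
  ext i
  have hi := Finset.ext_iff.1 hunion i
  simp only [Finset.mem_union, Cfg.available, Cfg.here, Finset.mem_filter, Finset.mem_univ,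
    true_and] at hi
  simp only [Cfg.available, Cfg.apply, Finset.mem_filter, Finset.mem_univ, true_and]
  split_ifs with hD hK
  · simpa only [reduceCtorEq, false_iff] using Finset.disjoint_left.1 hdisjoint hD
  · simpa only [true_iff] using hK
  · tauto

/-- The columns `l` encode the positions of the head and of the pebbles on the tape. The bound on
their number keeps the work tape short. -/
structure Encodes (x : M.Cfg w) (l : List (Col m)) : Prop where
  head : rowVal none l = x.head.val
  pebble : ∀ i c, x.pebble i = some c → rowVal (some i) l = c.val
  length : 2 ^ l.length ≤ 2 * (w.length + 1)

theorem Encodes.here_eq {x : M.Cfg w} {l : List (Col m)} (h : Encodes x l) :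
    (Finset.univ.filter fun i => rowVal (some i) l = rowVal none l) \ x.available = x.here := by
  ext i
  simp only [Cfg.available, Cfg.here, Finset.mem_sdiff, Finset.mem_filter, Finset.mem_univ,
    true_and]
  cases hi : x.pebble i with
  | none => simp only [not_true, and_false, reduceCtorEq]
  | some c =>
    simp only [h.pebble i c hi, h.head, Fin.ext_iff, reduceCtorEq, not_false_eq_true, and_true,
      Option.some.injEq]

theorem Encodes.apply {x : M.Cfg w} {l l' : List (Col m)} (h : Encodes x l)
    (r : M.Q × Finset (Fin m) × Finset (Fin m) × Move)
    (head : rowVal none l' = (r.2.2.2.onInput x.head).val)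
    (pebble : ∀ i, rowVal (some i) l' = if i ∈ r.2.1 then rowVal none l else rowVal (some i) l)
    (length : 2 ^ l'.length ≤ 2 * (w.length + 1)) : Encodes (x.apply r) l' := by
  refine ⟨head, fun i c hc => ?_, length⟩
  rw [pebble]
  simp only [Cfg.apply] at hc
  split_ifs at hc ⊢ with hD
  · cases hc
    exact h.head
  · exact h.pebble i c hc

/-- The relation between the configurations of a pebble automaton and the states of the program
that simulates it. -/
def Represents (x : M.Cfg w) (s : HeadMem M.Q m × TapeStore α (Option (Col m)) w) : Prop :=
  s.1.state = x.state ∧ s.1.avail = x.available ∧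
    ∃ l, Encodes x l ∧ s.2 = ⟨x.head, 1, listTape l⟩

theorem Represents.exists_exec_simulateStep {x : M.Cfg w}
    {s : HeadMem M.Q m × TapeStore α (Option (Col m)) w} (hs : Represents x s) :
    ∃ T, ExecBelow (4 * (Nat.log 2 w.length + 1)) M.simulateStep s T ∧
      (∀ s' ∈ T, ∃ x', M.Step w x x' ∧ Represents x' s') ∧
      ∀ x', M.Step w x x' → ∃ s' ∈ T, Represents x' s' := by
  obtain ⟨f, s⟩ := s
  obtain ⟨hstate, havail, l, hl, rfl⟩ := hs
  dsimp only at hstate havail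
  have hN := length_add_one_lt hl.length
  set f₁ : HeadMem M.Q m := ({ f with same := Finset.univ } : HeadMem M.Q m).compared l with hf₁
  have hchoose := exec_chooseTransition f₁ x.head l (by omega : 1 < 4 * (Nat.log 2 w.length + 1))
  have hδ : M.δ f₁.state (scan w x.head) (f₁.same \ f₁.avail) f₁.avail =
      M.δ x.state (scan w x.head) x.here x.available := by
    rw [← hl.here_eq, ← hstate, ← havail, hf₁, compared]
  rw [hδ] at hchoose
  have hupdate : ∀ r ∈ M.δ x.state (scan w x.head) x.here x.available,
      ∃ s', ExecBelow (4 * (Nat.log 2 w.length + 1))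
        M.updatePositions
        (M.chosen f₁ (scan w x.head) r, ⟨r.2.2.2.onInput x.head, 1, listTape l⟩) {s'} ∧
        Represents (x.apply r) s' := by
    intro r hr
    obtain ⟨ε, l', hexec, hhead, hpebble, hlen⟩ := exists_exec_updatePositions
      (M.chosen f₁ (scan w x.head) r) (r.2.2.2.onInput x.head)
      (by rw [hl.head]; exact Move.onInput_val r.2.2.2 x.head)
      (Nat.le_of_lt_succ (r.2.2.2.onInput x.head).isLt) hl.length
    exact ⟨_, hexec, rfl, (available_apply x hr).symm, l', hl.apply r hhead hpebble hlen, rfl⟩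
  have : Nonempty (HeadMem M.Q m × TapeStore α (Option (Col m)) w) := ⟨(f, ⟨x.head, 1, listTape l⟩)⟩
  choose! g hexec hg using hupdate
  refine ⟨_, (exec_comparePebbles f x.head l hN).seq_singleton (hchoose.seq_image hexec), ?_, ?_⟩
  · rintro _ ⟨r, hr, rfl⟩
    exact ⟨x.apply r, (step_iff _ _).2 ⟨r, hr, rfl⟩, hg r hr⟩
  · intro x' hx'
    obtain ⟨r, hr, rfl⟩ := (step_iff _ _).1 hx'
    exact ⟨g r, ⟨r, hr, rfl⟩, hg r hr⟩

/-- The initial memory for the simulation. -/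
def initMem (M : PebbleAutomaton α m) : HeadMem M.Q m :=
  ⟨M.start, Finset.univ, ∅, ∅, .stay⟩

theorem represents_init : Represents (M.init w) (M.initMem, ⟨0, 1, listTape []⟩) := by
  refine ⟨rfl, ?_, [], ⟨rfl, fun i c hc => ?_, ?_⟩, rfl⟩
  · exact (Finset.filter_true_of_mem fun _ _ => rfl).symm
  · cases hc
  · rw [List.length_nil]
    omega

variable (M) (w)

theorem exists_exec_simulation :
    ∃ T, ExecBelow (4 * (Nat.log 2 w.length + 1)) M.simulation
        (M.initMem, (⟨0, 0, fun _ => none⟩ : TapeStore α _ w)) T ∧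
      (T.Nonempty ↔ w ∈ M.language) := by
  have pos_lt : ∀ (x : M.Cfg w) (s : HeadMem M.Q m × TapeStore α (Option (Col m)) w),
      Represents x s → s.2.pos < 4 * (Nat.log 2 w.length + 1) := by
    rintro x ⟨f, s⟩ ⟨-, -, l, hl, rfl⟩
    exact Nat.lt_of_le_of_lt (Nat.le_add_left _ _) (length_add_one_lt hl.length)
  obtain ⟨T, hT, hiff⟩ := Exec.exists_loop_nonempty_iff (d := tapeDevice (Option (Col m)) w)
    (step := M.Step w) (t := fun f _ => f.state ∉ M.accept) (acc := fun x => x.state ∈ M.accept)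
    pos_lt (fun x r hr => by rw [hr.1]) (fun x r hr _ => hr.exists_exec_simulateStep)
    (represents_init (M := M) (w := w))
  refine ⟨T, Exec.seq_singleton ?_ hT, hiff⟩
  rw [listTape_nil]
  exact exec_moveWork _ _ _ (by dsimp only; omega) (by dsimp only [Move.onWork]; omega)

theorem exists_turingMachine : ∃ T : TuringMachine α 1, (M.IsDeterministic → T.IsDeterministic) ∧
    T.IsLogspace ∧ T.language = M.language := by
  have := M.finite_Q
  refine ⟨M.simulation.toTuring none M.initMem,
    fun hM => toTuring_isDeterministic (M.det_simulation hM), ⟨4, ?_⟩, ?_⟩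
  · refine toTuring_spaceBound fun w => ?_
    obtain ⟨T, hT, -⟩ := M.exists_exec_simulation w
    exact ⟨T, hT⟩
  · ext w
    obtain ⟨T, hT, hiff⟩ := M.exists_exec_simulation w
    exact (mem_language_toTuring hT).trans hiff

end PebbleAutomaton

/-! ### Pebbles as registers -/

namespace Prog

section Pebbles

variable {α F : Type*} {k : ℕ} {w : List α}

/-- Programs for a pebble automaton. -/
abbrev PebbleProg (α F : Type*) (k : ℕ) := Prog F (PebbleObs α k) (PebbleAct k)

/-- Execution of a program by a pebble automaton. -/
abbrev PebbleExec (p : PebbleProg α F k) (s : F × PebbleStore α k w)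
    (T : Set (F × PebbleStore α k w)) : Prop :=
  Exec (pebbleDevice k w) (fun _ => True) p s T

/-- The store in which the pebbles lie on the cells given by `v`. -/
def cellStore (v : Fin k → Cell w) (h : Cell w) : PebbleStore α k w :=
  ⟨h, fun i => some (v i)⟩

theorem obs_cellStore (v : Fin k → Cell w) (h : Cell w) :
    (pebbleDevice k w).obs (cellStore v h) =
      (scan w h, Finset.univ.filter fun i => v i = h, ∅) := by
  simp only [pebbleDevice, cellStore, Option.some.injEq, reduceCtorEq, Finset.filter_false]

/-- Move the head and leave the pebbles where they are. -/
def moveHead (ε : Move) : PebbleProg α F k :=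
  .act fun f o => {(f, some (o.2.1, ε))}

theorem det_moveHead (ε : Move) : (moveHead ε : PebbleProg α F k).Det :=
  fun _ _ => Set.subsingleton_singleton

theorem run_moveHead (ε : Move) (v : Fin k → Cell w) (h : Cell w) :
    (pebbleDevice k w).run (some (((pebbleDevice k w).obs (cellStore v h)).2.1, ε))
      (cellStore v h) = cellStore v (ε.onInput h) := by
  rw [obs_cellStore]
  simp only [Device.run, pebbleDevice, cellStore, PebbleStore.mk.injEq, true_and]
  funext i
  by_cases hi : v i = h <;>
    simp only [hi, Finset.mem_filter, Finset.mem_univ, Option.some.injEq, true_or, false_or,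
      reduceCtorEq, and_self, and_false, if_true, if_false]

theorem exec_moveHead (ε : Move) (f : F) (v : Fin k → Cell w) (h : Cell w) :
    PebbleExec (moveHead ε) (f, cellStore v h) {(f, cellStore v (ε.onInput h))} := by
  rw [← run_moveHead]
  exact Exec.act_of_eq_singleton rfl trivial trivial

/-- Move the head to the right until it reaches pebble `r`. -/
def seek (r : Fin k) : PebbleProg α F k :=
  .loop (fun _ o => r ∉ o.2.1) (moveHead .right)

theorem exec_seek (r : Fin k) (f : F) (v : Fin k → Cell w) :
    PebbleExec (seek r) (f, cellStore v 0) {(f, cellStore v (v r))} := by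
  have hr := (v r).isLt
  have loop := Exec.loop_of_sequence (d := pebbleDevice k w) (P := fun _ => True)
    (t := fun (_ : F) o => r ∉ o.2.1) (p := moveHead .right) (v r).val
    (fun i => (f, cellStore v ⟨min i (v r).val, by omega⟩)) ?_ ?_ ?_ trivial
  · simp only [Nat.zero_min, min_self] at loop
    exact loop
  · intro i hi
    simp only [obs_cellStore, Finset.mem_filter, Finset.mem_univ, true_and, Fin.ext_iff]
    omega
  · simp only [obs_cellStore, Finset.mem_filter, Finset.mem_univ, true_and, min_self,
      not_true, not_false_eq_true]
  · intro i hi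
    convert exec_moveHead .right f v _ using 5
    simp only [Move.onInput]
    omega

/-- Move the head to the left end of the tape. -/
def goHome : PebbleProg α F k :=
  .loop (fun _ o => o.1 ≠ .leftEnd) (moveHead .left)

theorem exec_goHome (f : F) (v : Fin k → Cell w) (h : Cell w) :
    PebbleExec goHome (f, cellStore v h) {(f, cellStore v 0)} := by
  have loop := Exec.loop_of_sequence (d := pebbleDevice k w) (P := fun _ => True)
    (t := fun (_ : F) o => o.1 ≠ .leftEnd) (p := moveHead .left) h.val
    (fun i => (f, cellStore v ⟨h.val - i, by omega⟩)) ?_ ?_ ?_ trivial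
  · simp only [Nat.sub_zero, Nat.sub_self] at loop
    exact loop
  · intro i hi
    simp only [obs_cellStore, ne_eq, scan_eq_leftEnd_iff]
    omega
  · simp only [obs_cellStore, ne_eq, scan_eq_leftEnd_iff, Nat.sub_self, not_true,
      not_false_eq_true]
  · exact fun i _ => exec_moveHead .left f v _

/-- Put down all pebbles at hand. -/
def dropPebbles : PebbleProg α F k :=
  .act fun f o => {(f, some (o.2.1 ∪ o.2.2, .stay))}

theorem det_dropPebbles : (dropPebbles : PebbleProg α F k).Det :=
  fun _ _ => Set.subsingleton_singleton

theorem run_dropPebbles (s : PebbleStore α k w) :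
    (pebbleDevice k w).run (some (((pebbleDevice k w).obs s).2.1 ∪ ((pebbleDevice k w).obs s).2.2,
      .stay)) s = cellStore (fun i => (s.pebble i).getD s.head) s.head := by
  simp only [Device.run, pebbleDevice, cellStore, PebbleStore.mk.injEq, Move.onInput, true_and]
  funext i
  cases hi : s.pebble i with
  | none => simp [hi]
  | some c => by_cases hc : c = s.head <;> simp [hi, hc]

theorem exec_dropPebbles (f : F) (s : PebbleStore α k w) :
    PebbleExec dropPebbles (f, s) {(f, cellStore (fun i => (s.pebble i).getD s.head) s.head)} := by
  rw [← run_dropPebbles]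
  exact Exec.act_of_eq_singleton rfl trivial trivial

/-- The store in which the pebbles except for `r` lie on the cells given by `v`. -/
def liftedStore (r : Fin k) (v : Fin k → Cell w) (h : Cell w) : PebbleStore α k w :=
  ⟨h, Function.update (fun i => some (v i)) r none⟩

theorem exec_dropPebbles_liftedStore (r : Fin k) (f : F) (v : Fin k → Cell w) (h : Cell w) :
    PebbleExec dropPebbles (f, liftedStore r v h) {(f, cellStore (Function.update v r h) h)} := by
  have hv : (fun i => ((liftedStore r v h).pebble i).getD h) = Function.update v r h :=
    funext fun i =>
      Function.apply_update (fun _ c => Option.getD c h) (fun i => some (v i)) r none i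
  rw [← hv]
  exact exec_dropPebbles f (liftedStore r v h)

/-- Move pebble `r` in a direction that depends on the memory and on the symbol in its cell, and
change the memory. -/
def movePebble (r : Fin k) (u : F → Symbol α → Set (F × Move)) : PebbleProg α F k :=
  .seq (seek r) (.seq (.act fun f o => (fun y => (y.1, some (o.2.1.erase r, y.2))) '' u f o.1)
    (.seq dropPebbles goHome))

theorem det_movePebble {r : Fin k} {u : F → Symbol α → Set (F × Move)}
    (hu : ∀ f a, (u f a).Subsingleton) : (movePebble r u).Det :=
  ⟨det_moveHead _, fun _ _ => (hu _ _).image _, det_dropPebbles, det_moveHead _⟩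

theorem run_lift (r : Fin k) (ε : Move) (v : Fin k → Cell w) :
    (pebbleDevice k w).run
        (some (((pebbleDevice k w).obs (cellStore v (v r))).2.1.erase r, ε)) (cellStore v (v r)) =
      liftedStore r v (ε.onInput (v r)) := by
  rw [obs_cellStore]
  simp only [Device.run, pebbleDevice, cellStore, liftedStore, PebbleStore.mk.injEq, true_and]
  funext i
  by_cases hir : i = r <;> by_cases hi : v i = v r <;> simp_all

theorem exec_movePebble (r : Fin k) (u : F → Symbol α → Set (F × Move)) (f : F)
    (v : Fin k → Cell w) :
    PebbleExec (movePebble r u) (f, cellStore v 0)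
      ((fun y => (y.1, cellStore (Function.update v r (y.2.onInput (v r))) 0)) ''
        u f (scan w (v r))) := by
  have lift : PebbleExec (.act fun f o => (fun y => (y.1, some (o.2.1.erase r, y.2))) '' u f o.1)
      (f, cellStore v (v r)) _ := Exec.act trivial fun _ _ _ => trivial
  simp only [Set.image_image, run_lift] at lift
  rw [obs_cellStore] at lift
  exact (exec_seek r f v).seq_singleton <| lift.seq_image fun y _ =>
    (exec_dropPebbles_liftedStore r _ v _).seq_singleton (exec_goHome _ _ _)

end Pebbles

section Registers

variable {α F R : Type*} {k : ℕ} {w : List α} (e : R ≃ Fin k)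

/-- The store in which register `r` holds `x r`: the pebble of the register lies on the cell with
this number. The position is truncated at the right end of the tape, since a cell is needed. -/
def regStore (w : List α) (x : R → ℕ) : PebbleStore α k w :=
  cellStore (fun i => ⟨min (x (e.symm i)) (w.length + 1), by omega⟩) 0

/-- Register `r` does not hold zero. -/
def nonzero (r : R) : F → PebbleObs α k → Prop := fun _ o => e r ∉ o.2.1

/-- Increase a register by one. -/
def inc (r : R) : PebbleProg α F k := movePebble (e r) fun f _ => {(f, .right)}

/-- Decrease a register by one. -/
def dec (r : R) : PebbleProg α F k := movePebble (e r) fun f _ => {(f, .left)}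

/-- Repeat `p` as often as the number in register `A` says, and clear this register. -/
def drain (A : R) (p : PebbleProg α F k) : PebbleProg α F k :=
  .loop (nonzero e A) (.seq (dec e A) p)

/-- Append the binary digit `bit` to the number in register `A`. The register `T` has to hold
zero. -/
def push (A T : R) (bit : F → Bool) : PebbleProg α F k :=
  .seq (drain e A (.seq (inc e T) (inc e T)))
    (.seq (drain e T (inc e A)) (.ite (fun f _ => bit f = true) (inc e A) .skip))

/-- Set the memory to the parity of register `A` by means of `set`, add half of `A` to `T`, and
clear `A`. -/
def halve (A T : R) (set : Bool → F → F) : PebbleProg α F k :=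
  drain e A (.ite (nonzero e A) (.seq (dec e A) (inc e T)) (.act fun f _ => {(set true f, none)}))

/-- Remove the last binary digit of the number in register `A` and store it by means of `set`. The
register `T` has to hold zero. -/
def pop (A T : R) (set : Bool → F → F) : PebbleProg α F k :=
  .seq (.act fun f _ => {(set false f, none)}) (.seq (halve e A T set) (drain e T (inc e A)))

theorem det_inc (r : R) : (inc e r : PebbleProg α F k).Det :=
  det_movePebble fun _ _ => Set.subsingleton_singleton

theorem det_dec (r : R) : (dec e r : PebbleProg α F k).Det :=
  det_movePebble fun _ _ => Set.subsingleton_singleton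

theorem det_push (A T : R) (bit : F → Bool) : (push e A T bit : PebbleProg α F k).Det :=
  ⟨⟨det_dec e A, det_inc e T, det_inc e T⟩, ⟨det_dec e T, det_inc e A⟩, det_inc e A, trivial⟩

theorem det_pop (A T : R) (set : Bool → F → F) : (pop e A T set : PebbleProg α F k).Det :=
  ⟨fun _ _ => Set.subsingleton_singleton,
    ⟨det_dec e A, ⟨det_dec e A, det_inc e T⟩, fun _ _ => Set.subsingleton_singleton⟩,
    det_dec e T, det_inc e A⟩

variable {e}

theorem nonzero_iff (f : F) (x : R → ℕ) (r : R) :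
    nonzero e r f ((pebbleDevice k w).obs (regStore e w x)) ↔ x r ≠ 0 := by
  rw [regStore, obs_cellStore]
  simp only [nonzero, Finset.mem_filter, Finset.mem_univ, Equiv.symm_apply_apply, true_and,
    Fin.ext_iff, Fin.val_zero]
  omega

variable [DecidableEq R] {A T : R}

theorem cellStore_update_eq_regStore (x : R → ℕ) (r : R) (c : Cell w) (y : ℕ)
    (hy : min y (w.length + 1) = c) :
    (cellStore (Function.update (fun i => ⟨min (x (e.symm i)) (w.length + 1), by omega⟩) (e r) c) 0
      : PebbleStore α k w) = regStore e w (Function.update x r y) := by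
  refine congrArg (cellStore · 0) (funext fun i => ?_)
  obtain ⟨r', rfl⟩ := e.surjective i
  rcases eq_or_ne r' r with rfl | h
  · simp only [Function.update_self, Equiv.symm_apply_apply, hy, Fin.eta]
  · simp only [Function.update_of_ne h, Function.update_of_ne (e.injective.ne h),
      Equiv.symm_apply_apply]

theorem exec_movePebble_regStore (u : F → Symbol α → Set (F × Move)) (f : F) (x : R → ℕ) {r : R}
    {c : Cell w} (hx : x r = c) :
    PebbleExec (movePebble (e r) u) (f, regStore e w x)
      ((fun y => (y.1, regStore e w (Function.update x r (y.2.onInput c)))) ''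
        u f (scan w c)) := by
  have hmove := exec_movePebble (w := w) (e r) u f
    (fun i => ⟨min (x (e.symm i)) (w.length + 1), by omega⟩)
  have hc : (⟨min (x (e.symm (e r))) (w.length + 1), by omega⟩ : Cell w) = c := by
    simp only [Equiv.symm_apply_apply, hx, Nat.min_eq_left (Nat.le_of_lt_succ c.isLt), Fin.eta]
  have hstore (c' : Cell w) := cellStore_update_eq_regStore (e := e) x r c' c'
    (Nat.min_eq_left (Nat.le_of_lt_succ c'.isLt))
  simp only [hc, hstore] at hmove
  exact hmove

theorem exec_inc (f : F) (x : R → ℕ) (r : R) :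
    PebbleExec (inc e r) (f, regStore e w x)
      {(f, regStore e w (Function.update x r (x r + 1)))} := by
  have hmove := exec_movePebble (w := w) (e r) (fun (f : F) _ => {(f, .right)}) f
    (fun i => ⟨min (x (e.symm i)) (w.length + 1), by omega⟩)
  rwa [Set.image_singleton, cellStore_update_eq_regStore x r _ (x r + 1)
    (by simp only [Move.onInput, Equiv.symm_apply_apply]; omega)] at hmove

theorem exec_dec (f : F) (x : R → ℕ) (r : R) (hx : x r ≤ w.length + 1) :
    PebbleExec (dec e r) (f, regStore e w x)
      {(f, regStore e w (Function.update x r (x r - 1)))} := by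
  have hmove := exec_movePebble (w := w) (e r) (fun (f : F) _ => {(f, .left)}) f
    (fun i => ⟨min (x (e.symm i)) (w.length + 1), by omega⟩)
  rwa [Set.image_singleton, cellStore_update_eq_regStore x r _ (x r - 1)
    (by simp only [Move.onInput, Equiv.symm_apply_apply]; omega)] at hmove

/-- The registers `x` with the values of `A` and `T` replaced by `a` and `t`. -/
def setTwo (x : R → ℕ) (A T : R) (a t : ℕ) : R → ℕ :=
  Function.update (Function.update x A a) T t

theorem setTwo_zero (x : R → ℕ) (hT : x T = 0) (hAT : A ≠ T) (a : ℕ) :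
    setTwo x A T a 0 = Function.update x A a := by
  rw [setTwo, Function.update_eq_self_iff, Function.update_of_ne hAT.symm, hT]

theorem setTwo_comm (x : R → ℕ) (hAT : A ≠ T) (a t : ℕ) :
    setTwo x A T a t = setTwo x T A t a :=
  Function.update_comm hAT _ _ _

theorem setTwo_left (x : R → ℕ) (hAT : A ≠ T) (a t : ℕ) : setTwo x A T a t A = a := by
  rw [setTwo, Function.update_of_ne hAT, Function.update_self]

theorem nonzero_left_iff (f : F) (x : R → ℕ) (hAT : A ≠ T) (a t : ℕ) :
    nonzero e A f ((pebbleDevice k w).obs (regStore e w (setTwo x A T a t))) ↔ a ≠ 0 := by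
  rw [nonzero_iff, setTwo_left x hAT]

theorem exec_inc_right (f : F) (x : R → ℕ) (a t : ℕ) :
    PebbleExec (inc e T) (f, regStore e w (setTwo x A T a t))
      {(f, regStore e w (setTwo x A T a (t + 1)))} := by
  simpa only [setTwo, Function.update_self, Function.update_idem] using
    exec_inc (w := w) (e := e) f (setTwo x A T a t) T

theorem exec_dec_left (f : F) (x : R → ℕ) (hAT : A ≠ T) {a t : ℕ} (ha : a + 1 ≤ w.length + 1) :
    PebbleExec (dec e A) (f, regStore e w (setTwo x A T (a + 1) t))
      {(f, regStore e w (setTwo x A T a t))} := by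
  have hdec := exec_dec (w := w) (e := e) f (setTwo x A T (a + 1) t) A (by rwa [setTwo_left x hAT])
  rwa [setTwo_left x hAT, Nat.add_sub_cancel, setTwo_comm x hAT, setTwo, Function.update_idem,
    ← setTwo, ← setTwo, ← setTwo_comm x hAT, ← setTwo_comm x hAT] at hdec

theorem exec_drain {p : PebbleProg α F k} {c : ℕ} (f : F) (x : R → ℕ) (hAT : A ≠ T) (a : ℕ)
    (hp : ∀ a t, PebbleExec p (f, regStore e w (setTwo x A T a t))
      {(f, regStore e w (setTwo x A T a (t + c)))}) (ha : a ≤ w.length + 1) :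
    PebbleExec (drain e A p) (f, regStore e w (setTwo x A T a 0))
      {(f, regStore e w (setTwo x A T 0 (c * a)))} := by
  have loop := Exec.loop_of_sequence (d := pebbleDevice k w) (P := fun _ => True)
    (t := nonzero e A) (p := .seq (dec e A) p) a
    (fun i => (f, regStore e w (setTwo x A T (a - i) (c * i)))) ?_ ?_ ?_ trivial
  · simp only [Nat.sub_zero, Nat.mul_zero, Nat.sub_self] at loop
    exact loop
  · exact fun i hi => (nonzero_left_iff _ _ hAT _ _).2 (Nat.sub_ne_zero_of_lt hi)
  · exact fun h => (nonzero_left_iff _ _ hAT _ _).1 h (Nat.sub_self a)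
  · intro i hi
    obtain ⟨b, hb⟩ : ∃ b, a - i = b + 1 := ⟨a - i - 1, by omega⟩
    simp only [hb, show a - (i + 1) = b by omega]
    exact (exec_dec_left f x hAT (by omega)).seq_singleton (hp _ _)

theorem exec_moveBack (f : F) (x : R → ℕ) (hT : x T = 0) (hAT : A ≠ T) (t : ℕ)
    (ht : t ≤ w.length + 1) :
    PebbleExec (drain e T (inc e A)) (f, regStore e w (setTwo x A T 0 t))
      {(f, regStore e w (Function.update x A t))} := by
  have hdrain := exec_drain (w := w) f x hAT.symm t (exec_inc_right (e := e) f x) ht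
  rwa [Nat.one_mul, ← setTwo_comm x hAT, ← setTwo_comm x hAT, setTwo_zero x hT hAT] at hdrain

theorem exec_push (f : F) (x : R → ℕ) (hT : x T = 0) (hAT : A ≠ T) (bit : F → Bool)
    (hx : 2 * x A ≤ w.length + 1) :
    PebbleExec (push e A T bit) (f, regStore e w x)
      {(f, regStore e w (Function.update x A (2 * x A + (bit f).toNat)))} := by
  have double := exec_drain (w := w) (e := e) (c := 2) f x hAT (x A)
    (fun a t => (exec_inc_right f x a t).seq_singleton (exec_inc_right f x a (t + 1))) (by omega)
  rw [setTwo_zero x hT hAT, Function.update_eq_self] at double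
  refine double.seq_singleton ((exec_moveBack f x hT hAT _ hx).seq_singleton ?_)
  cases hb : bit f with
  | false =>
    exact .iteFalse (by simp only [hb, Bool.false_eq_true, not_false_eq_true]) (.skip trivial)
  | true =>
    refine .iteTrue hb ?_
    simpa only [Bool.toNat_true, Function.update_self, Function.update_idem] using
      exec_inc (w := w) (e := e) f (Function.update x A (2 * x A)) A

theorem exec_halve (f : F) (x : R → ℕ) (hAT : A ≠ T) (set : Bool → F → F)
    (hset : ∀ b b', set b (set b' f) = set b f) (a t : ℕ) (ha : a ≤ w.length + 1) :
    PebbleExec (halve e A T set) (set false f, regStore e w (setTwo x A T a t))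
      {(set (decide (a % 2 = 1)) f, regStore e w (setTwo x A T 0 (t + a / 2)))} := by
  have not_nonzero (f : F) (t : ℕ) :
      ¬ nonzero e A f ((pebbleDevice k w).obs (regStore e w (setTwo x A T 0 t))) :=
    fun h => (nonzero_left_iff _ _ hAT _ _).1 h rfl
  induction a using Nat.twoStepInduction generalizing t with
  | zero => exact .loopFalse trivial (not_nonzero _ t)
  | one =>
    have odd : PebbleExec (.act fun f _ => {(set true f, none)})
        (set false f, regStore e w (setTwo x A T 0 t))
        {(set true f, regStore e w (setTwo x A T 0 t))} :=
      Exec.act_of_eq_singleton (a := none) (by rw [hset]) trivial trivial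
    exact .loopTrue ((nonzero_left_iff _ _ hAT _ _).2 one_ne_zero) <| Exec.seq_singleton
      ((exec_dec_left _ x hAT ha).seq_singleton (.iteFalse (not_nonzero _ t) odd))
      (.loopFalse trivial (not_nonzero _ t))
  | more a ih _ =>
    have loop := ih (t + 1) (by omega)
    rw [show t + 1 + a / 2 = t + (a + 2) / 2 by omega, show a % 2 = (a + 2) % 2 by omega] at loop
    refine .loopTrue ((nonzero_left_iff _ _ hAT _ _).2 (by omega)) <| Exec.seq_singleton
      ((exec_dec_left _ x hAT ha).seq_singleton ?_) loop
    exact .iteTrue ((nonzero_left_iff _ _ hAT _ _).2 (by omega)) <|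
      (exec_dec_left _ x hAT (by omega)).seq_singleton (exec_inc_right _ x a t)

theorem exec_pop (f : F) (x : R → ℕ) (hT : x T = 0) (hAT : A ≠ T) (set : Bool → F → F)
    (hset : ∀ b b', set b (set b' f) = set b f) (hx : x A ≤ w.length + 1) :
    PebbleExec (pop e A T set) (f, regStore e w x)
      {(set (decide (x A % 2 = 1)) f, regStore e w (Function.update x A (x A / 2)))} := by
  have clear : PebbleExec (.act fun f _ => {(set false f, none)}) (f, regStore e w x)
      {(set false f, regStore e w x)} := Exec.act_of_eq_singleton (a := none) rfl trivial trivial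
  have halve := exec_halve (w := w) (e := e) f x hAT set hset (x A) 0 hx
  rw [setTwo_zero x hT hAT, Function.update_eq_self, Nat.zero_add] at halve
  exact clear.seq_singleton (halve.seq_singleton (exec_moveBack _ x hT hAT _ (by omega)))

end Registers

end Prog

namespace Prog

theorem Exec.forEach_update {F O A S ι β : Type*} {d : Device O A S} {P : S → Prop}
    [DecidableEq ι] {p : ι → Prog F O A} (I : Finset ι) (s : (ι → β) → F × S) (f g : ι → β)
    (h : ∀ i ∈ I, ∀ v, v i = f i → Exec d P (p i) (s v) {s (Function.update v i (g i))})
    (hP : P (s (I.piecewise g f)).2) :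
    Exec d P (Prog.forEach I.toList p) (s f) {s (I.piecewise g f)} := by
  have hforEach := Exec.forEach (d := d) (P := P) (l := I.toList) (p := p)
    (fun l => s (l.toFinset.piecewise g f)) ?_ ?_
  · convert hforEach using 3
    · exact (Finset.piecewise_empty ..).symm
    · funext i
      simp only [Finset.piecewise, List.mem_toFinset, Finset.mem_toList]
  · intro l₁ i l₂ hl
    have hi : i ∉ l₁ := fun hi =>
      List.disjoint_of_nodup_append (hl ▸ I.nodup_toList) hi List.mem_cons_self
    have hmem : i ∈ I := Finset.mem_toList.1 (hl ▸ List.mem_append_right _ List.mem_cons_self)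
    rw [List.toFinset_append, List.toFinset_cons, List.toFinset_nil, Finset.union_insert,
      Finset.union_empty, Finset.piecewise_insert]
    exact h i hmem _ (Finset.piecewise_eq_of_notMem _ _ _ (mt List.mem_toFinset.1 hi))
  · rwa [Finset.toList_toFinset]

end Prog

/-! ### Binary tapes -/

/-- The number with binary digits `b 0, …, b (o - 1)`, most significant digit first. -/
def leftVal (b : ℕ → Bool) (o : ℕ) : ℕ := Nat.ofBits fun i : Fin o => b (o - 1 - i)

/-- The number with binary digits `b o, …, b (o + d - 1)`, least significant digit first. -/
def rightVal (b : ℕ → Bool) (o d : ℕ) : ℕ := Nat.ofBits fun i : Fin d => b (o + i)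

theorem leftVal_succ (b : ℕ → Bool) (o : ℕ) :
    leftVal b (o + 1) = 2 * leftVal b o + (b o).toNat := by
  rw [leftVal, leftVal, Nat.ofBits_succ]
  simp only [Function.comp_def, Fin.val_succ, Fin.val_zero, Nat.add_sub_cancel, Nat.sub_zero,
    Nat.sub_sub, Nat.add_comm]

theorem rightVal_succ (b : ℕ → Bool) (o d : ℕ) :
    rightVal b o (d + 1) = 2 * rightVal b (o + 1) d + (b o).toNat := by
  rw [rightVal, rightVal, Nat.ofBits_succ]
  simp only [Function.comp_def, Fin.val_succ, Fin.val_zero, Nat.add_zero, Nat.add_assoc,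
    Nat.add_comm 1]

theorem leftVal_congr {b b' : ℕ → Bool} {o : ℕ} (h : ∀ i < o, b i = b' i) :
    leftVal b o = leftVal b' o :=
  congrArg Nat.ofBits (funext fun _ => h _ (by omega))

theorem rightVal_congr {b b' : ℕ → Bool} {o d : ℕ} (h : ∀ i, o ≤ i → b i = b' i) :
    rightVal b o d = rightVal b' o d :=
  congrArg Nat.ofBits (funext fun _ => h _ (by omega))

theorem rightVal_eq_zero {b : ℕ → Bool} {o : ℕ} (d : ℕ) (h : ∀ i, o ≤ i → b i = false) :
    rightVal b o d = 0 := by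
  induction d generalizing o with
  | zero => rfl
  | succ d ih => rw [rightVal_succ, ih fun i hi => h i (by omega), h o le_rfl, Bool.toNat_false]

/-- The registers that represent binary tapes with index set `T`, the tracks, next to the position
of the input head: an auxiliary register, and for each track two numbers whose binary digits are
the bits to the left (`side false t`) and to the right (`side true t`) of the scanned bit. -/
inductive TrackReg (T : Type*)
  | input
  | aux
  | side (d : Bool) (t : T)
  deriving DecidableEq

instance {T : Type*} [Finite T] : Finite (TrackReg T) :=
  Finite.of_surjective (α := Option (Option (Bool × T)))
    (fun | none => .input | some none => .aux | some (some (d, t)) => .side d t) fun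
    | .input => ⟨none, rfl⟩
    | .aux => ⟨some none, rfl⟩
    | .side d t => ⟨some (some (d, t)), rfl⟩

/-- The contents of the registers for tracks `b` of length `l` that are scanned at `col`. -/
def trackRegs {T : Type*} (l : ℕ) (b : T → ℕ → Bool) (col : T → ℕ) (h : ℕ) : TrackReg T → ℕ
  | .input => h
  | .aux => 0
  | .side false t => leftVal (b t) (col t)
  | .side true t => rightVal (b t) (col t + 1) (l - (col t + 1))

section Tracks

open Prog

variable {α C T : Type*} {N : ℕ} {w : List α}

theorem trackRegs_congr {l : ℕ} {b b' : T → ℕ → Bool} {col : T → ℕ} {h : ℕ}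
    (hb : ∀ t i, i ≠ col t → b t i = b' t i) : trackRegs l b col h = trackRegs l b' col h := by
  funext r
  match r with
  | .input => rfl
  | .aux => rfl
  | .side false t => exact leftVal_congr fun i hi => hb t i (Nat.ne_of_lt hi)
  | .side true t => exact rightVal_congr fun i hi => hb t i (Nat.ne_of_gt hi)

theorem update_trackRegs_input [DecidableEq T] (l : ℕ) (b : T → ℕ → Bool) (col : T → ℕ)
    (h h' : ℕ) :
    Function.update (trackRegs l b col h) .input h' = trackRegs l b col h' := by
  funext r
  match r with
  | .input => exact Function.update_self ..
  | .aux => rfl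
  | .side false t => rfl
  | .side true t => rfl

variable (e : TrackReg T ≃ Fin N)

/-- The state of a program that works on tracks, with control `c`. The scanned bits are part of
the memory. -/
def trackState (w : List α) (l : ℕ) (c : C) (b : T → ℕ → Bool) (col : T → ℕ) (h : ℕ) :
    (C × (T → Bool)) × PebbleStore α N w :=
  ((c, fun t => b t (col t)), regStore e w (trackRegs l b col h))

variable [DecidableEq T]

/-- Move the head of track `t` to the left (`d = true`) or to the right (`d = false`): the scanned
bit is pushed to the register on one side and a bit is popped from the other one. -/
def shift (d : Bool) (t : T) : PebbleProg α (C × (T → Bool)) N :=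
  .seq (push e (.side d t) .aux fun f => f.2 t)
    (pop e (.side (!d) t) .aux fun b f => (f.1, Function.update f.2 t b))

/-- Move the heads of the tracks in `I`. -/
noncomputable def shiftTracks (d : Bool) (I : Finset T) : PebbleProg α (C × (T → Bool)) N :=
  forEach I.toList (shift e d)

theorem det_shiftTracks (d : Bool) (I : Finset T) :
    (shiftTracks e d I : PebbleProg α (C × (T → Bool)) N).Det :=
  det_forEach fun _ => ⟨det_push .., det_pop ..⟩

variable {e} {l : ℕ} {c : C} {b : T → ℕ → Bool} {col : T → ℕ} {h : ℕ} {d : Bool} {t : T} {o : ℕ}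

theorem trackRegs_update_col (l : ℕ) (b : T → ℕ → Bool) (col : T → ℕ) (h : ℕ) (d : Bool) (t : T)
    (o : ℕ) :
    trackRegs l b (Function.update col t o) h =
      Function.update (Function.update (trackRegs l b col h)
        (.side d t) (trackRegs l b (Function.update col t o) h (.side d t)))
        (.side (!d) t) (trackRegs l b (Function.update col t o) h (.side (!d) t)) := by
  funext r
  match r with
  | .input => rfl
  | .aux => rfl
  | .side d' t' =>
    by_cases ht : t' = t
    · subst ht
      cases d <;> cases d' <;> simp
    · cases d' <;> simp [trackRegs, ht]

theorem exec_shift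
    (hpush : trackRegs l b (Function.update col t o) h (.side d t) =
      2 * trackRegs l b col h (.side d t) + (b t (col t)).toNat)
    (hpop : trackRegs l b col h (.side (!d) t) =
      2 * trackRegs l b (Function.update col t o) h (.side (!d) t) + (b t o).toNat)
    (hd : trackRegs l b (Function.update col t o) h (.side d t) ≤ w.length + 1)
    (hd' : trackRegs l b col h (.side (!d) t) ≤ w.length + 1) :
    PebbleExec (shift e d t) (trackState e w l c b col h)
      {trackState e w l c b (Function.update col t o) h} := by
  have hne : (.side (!d) t : TrackReg T) ≠ .side d t := by cases d <;> simp
  have push := exec_push (w := w) (e := e) (A := .side d t) (T := .aux)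
    ((c, fun t => b t (col t)) : C × (T → Bool)) (trackRegs l b col h) rfl
    (by simp) (fun f => f.2 t) (by omega)
  have pop := exec_pop (w := w) (e := e) (A := .side (!d) t) (T := .aux)
    ((c, fun t => b t (col t)) : C × (T → Bool))
    (Function.update (trackRegs l b col h) (.side d t)
      (trackRegs l b (Function.update col t o) h (.side d t))) rfl (by simp)
    (fun b f => (f.1, Function.update f.2 t b))
    (fun _ _ => by rw [Function.update_idem]) (by rwa [Function.update_of_ne hne])
  rw [← hpush] at push
  have hbit : decide (trackRegs l b col h (.side (!d) t) % 2 = 1) = b t o := by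
    rw [hpop]
    cases b t o <;> simp
  have hhalf : trackRegs l b col h (.side (!d) t) / 2 =
      trackRegs l b (Function.update col t o) h (.side (!d) t) := by
    have := (b t o).toNat_le
    omega
  rw [Function.update_of_ne hne, hbit, hhalf, ← trackRegs_update_col,
    show Function.update (fun t => b t (col t)) t (b t o) =
        fun t' => b t' (Function.update col t o t')
      from funext fun t' => (Function.apply_update (fun t => b t) col t o t').symm] at pop
  exact push.seq_singleton pop

theorem exec_shift_right (hl : 2 ^ l ≤ w.length + 2) (ht : col t + 1 < l) :
    PebbleExec (shift e false t) (trackState e w l c b col h)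
      {trackState e w l c b (Function.update col t (col t + 1)) h} := by
  have hright : 2 ^ (l - (col t + 1)) ≤ 2 ^ l := Nat.pow_le_pow_right two_pos (Nat.sub_le ..)
  have hleft : 2 ^ (col t + 1) ≤ 2 ^ l := Nat.pow_le_pow_right two_pos ht.le
  have hsplit := rightVal_succ (b t) (col t + 1) (l - (col t + 1 + 1))
  rw [show l - (col t + 1 + 1) + 1 = l - (col t + 1) by omega] at hsplit
  refine exec_shift ?_ ?_ ?_ ?_ <;> simp only [trackRegs, Function.update_self, Bool.not_false]
  · exact leftVal_succ ..
  · exact hsplit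
  · exact Nat.le_of_lt_succ ((Nat.ofBits_lt_two_pow _).trans_le (hleft.trans hl))
  · exact Nat.le_of_lt_succ ((Nat.ofBits_lt_two_pow _).trans_le (hright.trans hl))

theorem exec_shift_left (hl : 2 ^ l ≤ w.length + 2) (ho : col t = o + 1) (ht : col t < l) :
    PebbleExec (shift e true t) (trackState e w l c b col h)
      {trackState e w l c b (Function.update col t o) h} := by
  have hright : 2 ^ (l - (o + 1)) ≤ 2 ^ l := Nat.pow_le_pow_right two_pos (Nat.sub_le ..)
  have hleft : 2 ^ (o + 1) ≤ 2 ^ l := Nat.pow_le_pow_right two_pos (by omega)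
  have hsplit := rightVal_succ (b t) (o + 1) (l - (o + 1 + 1))
  rw [show l - (o + 1 + 1) + 1 = l - (o + 1) by omega] at hsplit
  refine exec_shift ?_ ?_ ?_ ?_ <;> simp only [trackRegs, Function.update_self, Bool.not_true, ho]
  · exact hsplit
  · exact leftVal_succ ..
  · exact Nat.le_of_lt_succ ((Nat.ofBits_lt_two_pow _).trans_le (hright.trans hl))
  · exact Nat.le_of_lt_succ ((Nat.ofBits_lt_two_pow _).trans_le (hleft.trans hl))

end Tracks

/-! ### Simulation of a Turing machine by a pebble automaton -/

namespace TuringMachine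

open Prog

section Columns

variable {B : ℕ}

/-- Work tapes are cut into columns of `B + 1` cells: the pair `(i, c)` stands for the `c`-th cell
of the `i`-th column. -/
def cellIndex : ℕ × Fin (B + 1) ≃ ℕ := (Nat.divModEquiv (B + 1)).symm

theorem cellIndex_apply (x : ℕ × Fin (B + 1)) : cellIndex x = x.1 * (B + 1) + x.2 := rfl

theorem column_lt {x : ℕ × Fin (B + 1)} {l : ℕ} (h : cellIndex x < (B + 1) * l) : x.1 < l := by
  rw [cellIndex_apply, Nat.mul_comm] at h
  exact Nat.lt_of_mul_lt_mul_left ((Nat.le_add_right _ _).trans_lt h)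

/-- The movement of a work head within a column. -/
def moveInColumn : Move → Fin (B + 1) → Fin (B + 1)
  | .left, c => ⟨c.val - 1, by omega⟩
  | .stay, c => c
  | .right, c => ⟨min (c.val + 1) B, by omega⟩

open Classical in
/-- The movement of a work head, in terms of columns. -/
noncomputable def moveCell (ε : Move) (x : ℕ × Fin (B + 1)) : ℕ × Fin (B + 1) :=
  if ε = .right ∧ x.2 = Fin.last B then (x.1 + 1, 0)
  else if ε = .left ∧ x.2 = 0 ∧ x.1 ≠ 0 then (x.1 - 1, Fin.last B)
  else (x.1, moveInColumn ε x.2)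

theorem cellIndex_moveCell (ε : Move) (x : ℕ × Fin (B + 1)) :
    cellIndex (moveCell ε x) = ε.onWork (cellIndex x) := by
  obtain ⟨i, c⟩ := x
  unfold moveCell
  split_ifs with hright hleft
  · obtain ⟨rfl, rfl⟩ : ε = .right ∧ c = Fin.last B := hright
    simp only [cellIndex_apply, Move.onWork, Fin.val_zero, Fin.val_last, Nat.succ_mul]
    omega
  · obtain ⟨rfl, rfl, hi⟩ : ε = .left ∧ c = 0 ∧ i ≠ 0 := hleft
    obtain ⟨i, rfl⟩ := Nat.exists_eq_succ_of_ne_zero hi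
    simp only [cellIndex_apply, Move.onWork, Fin.val_zero, Fin.val_last, Nat.succ_mul,
      Nat.succ_eq_add_one, Nat.add_sub_cancel]
    omega
  · simp only [Fin.ext_iff, Fin.val_last, Fin.val_zero] at hright hleft
    simp only [cellIndex_apply]
    cases ε with
    | left =>
      simp only [moveInColumn, Move.onWork]
      rcases Nat.eq_zero_or_pos i with rfl | hi
      · omega
      · have : c.val ≠ 0 := fun hc => hleft ⟨rfl, hc, hi.ne'⟩
        omega
    | stay => rfl
    | right =>
      have : c.val ≠ B := fun hc => hright ⟨rfl, hc⟩
      simp only [moveInColumn, Move.onWork]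
      omega

end Columns

/-- The tracks for `k` work tapes over `Γ`. Track `(j, none)` marks the first column of tape `j`;
track `(j, some (c, γ))` consists of the bits `γ` of the codes of the symbols in the `c`-th cells
of the columns of tape `j`. -/
abbrev Track (k B : ℕ) (Γ : Type*) := Fin k × Option (Fin (B + 1) × Γ)

/-- The control of the simulation: the state, the positions of the work heads in the scanned
columns, and the moves that the work heads still have to make. -/
structure Control (Q : Type*) (k B : ℕ) where
  state : Q
  off : Fin k → Fin (B + 1)
  pending : Fin k → Move

instance {Q : Type*} [Finite Q] {k B : ℕ} : Finite (Control Q k B) :=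
  Finite.of_injective (β := Q × (Fin k → Fin (B + 1)) × (Fin k → Move))
    (fun x => (x.state, x.off, x.pending)) fun x y h => by
      cases x
      cases y
      simpa only [Prod.mk.injEq, Control.mk.injEq] using h

/-- The memory of the simulation. -/
abbrev SimMem (Q Γ : Type*) (k B : ℕ) := Control Q k B × (Track k B Γ → Bool)

section Symbols

variable {Γ : Type*} [DecidableEq Γ] {k B : ℕ}

/-- A binary code of the work alphabet for which the code of the blank symbol is zero, so that
blank tapes correspond to registers that hold zero. -/
def code (blank γ γ' : Γ) : Bool := decide (γ = γ' ∧ γ' ≠ blank)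

theorem code_blank (blank γ : Γ) : code blank blank γ = false :=
  decide_eq_false fun h => h.2 h.1.symm

theorem code_injective (blank : Γ) : Function.Injective (code blank) := by
  intro γ₁ γ₂ h
  have h₁ := congrFun h γ₁
  have h₂ := congrFun h γ₂
  simp only [code, decide_eq_decide, true_and] at h₁ h₂
  by_cases hγ : γ₁ = blank <;> by_cases hγ' : γ₂ = blank <;> simp_all

/-- The tracks that correspond to the contents of the work tapes. -/
def contents (blank : Γ) (tape : Fin k → ℕ → Γ) : Track k B Γ → ℕ → Bool
  | (_, none), i => decide (i = 0)
  | (j, some (c, γ)), i => code blank (tape j (cellIndex (i, c))) γ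

/-- The symbols that are scanned by the work heads. -/
noncomputable def readSymbols {Q : Type*} (blank : Γ) (f : SimMem Q Γ k B) (j : Fin k) : Γ :=
  have : Nonempty Γ := ⟨blank⟩
  Function.invFun (code blank) fun γ => f.2 (j, some (f.1.off j, γ))

/-- The bits in the scanned columns after the work heads have written `g`. -/
def writeSymbols {Q : Type*} (blank : Γ) (f : SimMem Q Γ k B) (g : Fin k → Γ) :
    Track k B Γ → Bool
  | (j, none) => f.2 (j, none)
  | (j, some (c, γ)) => if c = f.1.off j then code blank (g j) γ else f.2 (j, some (c, γ))

/-- The contents of the work tapes after the heads at `pos` have written `g`. -/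
def written (tape : Fin k → ℕ → Γ) (pos : Fin k → ℕ × Fin (B + 1)) (g : Fin k → Γ) (j : Fin k) :
    ℕ → Γ :=
  Function.update (tape j) (cellIndex (pos j)) (g j)

theorem contents_written_of_ne (blank : Γ) (tape : Fin k → ℕ → Γ) (pos : Fin k → ℕ × Fin (B + 1))
    (g : Fin k → Γ) {t : Track k B Γ} {i : ℕ} (hi : i ≠ (pos t.1).1) :
    contents blank (written tape pos g) t i = contents blank tape t i := by
  obtain ⟨j, _ | ⟨c, γ⟩⟩ := t
  · rfl
  · have hcell : cellIndex (i, c) ≠ cellIndex (pos j) := fun h =>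
      hi (congrArg Prod.fst (cellIndex.injective h))
    simp only [contents, written, Function.update_of_ne hcell]

theorem writeSymbols_contents {Q : Type*} (blank : Γ) (q : Q) (pending : Fin k → Move)
    (tape : Fin k → ℕ → Γ) (pos : Fin k → ℕ × Fin (B + 1)) (g : Fin k → Γ) :
    writeSymbols blank (⟨q, fun j => (pos j).2, pending⟩,
        fun t => contents blank tape t (pos t.1).1) g =
      fun t => contents blank (written tape pos g) t (pos t.1).1 := by
  funext t
  obtain ⟨j, _ | ⟨c, γ⟩⟩ := t
  · rfl
  · simp only [writeSymbols, contents, written]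
    split_ifs with hc
    · rw [hc, Prod.mk.eta, Function.update_self]
    · rw [Function.update_of_ne fun h => hc (congrArg Prod.snd (cellIndex.injective h))]

end Symbols

section Machine

variable {α Q Γ : Type*} {k B N : ℕ} {w : List α} {e : TrackReg (Track k B Γ) ≃ Fin N}
  {q : Q} {pending : Fin k → Move} {h : ℕ}

/-- Change the position of a work head in the scanned column. -/
def setOff (j : Fin k) (u : Move → Fin (B + 1) → Fin (B + 1)) : PebbleProg α (SimMem Q Γ k B) N :=
  .act fun f _ => {(({ f.1 with
    off := Function.update f.1.off j (u (f.1.pending j) (f.1.off j)) }, f.2), none)}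

theorem exec_setOff {off : Fin k → Fin (B + 1)} {b : Track k B Γ → ℕ → Bool}
    {col : Track k B Γ → ℕ} (j : Fin k) (u : Move → Fin (B + 1) → Fin (B + 1)) :
    PebbleExec (setOff j u) (trackState e w l (⟨q, off, pending⟩ : Control Q k B) b col h)
      {trackState e w l ⟨q, Function.update off j (u (pending j) (off j)), pending⟩ b col h} :=
  Exec.act_of_eq_singleton (a := none) rfl trivial trivial

variable [DecidableEq Γ] (e)

/-- The state of the simulation for given contents of the work tapes and given positions of the
heads. -/
def cfgState (w : List α) (l : ℕ) (blank : Γ) (q : Q) (pending : Fin k → Move)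
    (tape : Fin k → ℕ → Γ) (pos : Fin k → ℕ × Fin (B + 1)) (h : ℕ) :
    SimMem Q Γ k B × PebbleStore α N w :=
  trackState e w l ⟨q, fun j => (pos j).2, pending⟩ (contents blank tape)
    (fun t => (pos t.1).1) h

variable {e} {l : ℕ} {blank : Γ} {tape : Fin k → ℕ → Γ} {pos : Fin k → ℕ × Fin (B + 1)}

theorem readSymbols_cfgState :
    readSymbols blank (cfgState e w l blank q pending tape pos h).1 =
      fun j => tape j (cellIndex (pos j)) :=
  funext fun j =>
    have : Nonempty Γ := ⟨blank⟩
    Function.leftInverse_invFun (code_injective blank) (tape j (cellIndex (pos j)))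

theorem cfgState_written (q' : Q) (pending' : Fin k → Move) (g : Fin k → Γ) (h' : ℕ) :
    cfgState e w l blank q' pending' (written tape pos g) pos h' =
      ((⟨q', (cfgState e w l blank q pending tape pos h).1.1.off, pending'⟩,
          writeSymbols blank (cfgState e w l blank q pending tape pos h).1 g),
        regStore e w (Function.update
          (trackRegs l (contents blank tape) (fun t => (pos t.1).1) h) .input h')) := by
  rw [update_trackRegs_input]
  have hregs : trackRegs l (contents blank (written tape pos g)) (fun t => (pos t.1).1) h' =
      trackRegs l (contents blank tape) (fun t => (pos t.1).1) h' :=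
    trackRegs_congr fun t i hi => contents_written_of_ne blank tape pos g hi
  exact Prod.ext (Prod.ext rfl (writeSymbols_contents ..).symm) (congrArg (regStore e w) hregs)

theorem cfgState_update_pos (j : Fin k) (x : ℕ × Fin (B + 1)) :
    cfgState e w l blank q pending tape (Function.update pos j x) h =
      trackState e w l ⟨q, Function.update (fun j => (pos j).2) j x.2, pending⟩
        (contents blank tape) (fun t => Function.update (fun j => (pos j).1) j x.1 t.1) h := by
  simp only [cfgState, Function.apply_update (fun _ => Prod.fst),
    Function.apply_update (fun _ => Prod.snd)]

variable [Fintype Γ] (e)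

/-- Move the heads of the tracks of work tape `j`. -/
noncomputable def shiftTape (d : Bool) (j : Fin k) : PebbleProg α (SimMem Q Γ k B) N :=
  shiftTracks e d (Finset.univ.filter fun t => t.1 = j)

/-- Move the head of work tape `j`. The mark of the first column tells whether the head can move
to the left. -/
noncomputable def moveTape (j : Fin k) : PebbleProg α (SimMem Q Γ k B) N :=
  .ite (fun f _ => f.1.pending j = .right ∧ f.1.off j = Fin.last B)
    (.seq (setOff j fun _ _ => 0) (shiftTape e false j))
    (.ite (fun f _ => f.1.pending j = .left ∧ f.1.off j = 0 ∧ f.2 (j, none) = false)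
      (.seq (setOff j fun _ _ => Fin.last B) (shiftTape e true j))
      (setOff j moveInColumn))

/-- Move all work heads. -/
noncomputable def moveTapes : PebbleProg α (SimMem Q Γ k B) N :=
  forEach Finset.univ.toList (moveTape e)

theorem det_moveTape (j : Fin k) : (moveTape e j : PebbleProg α (SimMem Q Γ k B) N).Det :=
  ⟨⟨fun _ _ => Set.subsingleton_singleton, det_shiftTracks e _ _⟩,
    ⟨fun _ _ => Set.subsingleton_singleton, det_shiftTracks e _ _⟩,
    fun _ _ => Set.subsingleton_singleton⟩

variable {e}

theorem exec_shiftTape {d : Bool} {j : Fin k} {c : Control Q k B} {b : Track k B Γ → ℕ → Bool}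
    {col : Fin k → ℕ} {o : ℕ}
    (hshift : ∀ (t : Track k B Γ) (col' : Track k B Γ → ℕ), t.1 = j → col' t = col j →
      PebbleExec (shift e d t) (trackState e w l c b col' h)
        {trackState e w l c b (Function.update col' t o) h}) :
    PebbleExec (shiftTape e d j) (trackState e w l c b (fun t => col t.1) h)
      {trackState e w l c b (fun t => Function.update col j o t.1) h} := by
  have hforEach := Exec.forEach_update (d := pebbleDevice N w) (P := fun _ => True)
    (p := shift e d) (Finset.univ.filter fun t : Track k B Γ => t.1 = j)
    (fun col => trackState e w l c b col h) (fun t => col t.1) (fun _ => o)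
    (fun t ht col' hcol' =>
      have ht' : t.1 = j := (Finset.mem_filter.1 ht).2
      hshift t col' ht' (by rw [hcol', ht'])) trivial
  have hcol : (Finset.univ.filter fun t : Track k B Γ => t.1 = j).piecewise (fun _ => o)
      (fun t => col t.1) = fun t => Function.update col j o t.1 := by
    funext t
    simp only [Finset.piecewise, Finset.mem_filter, Finset.mem_univ, true_and,
      Function.update_apply]
  rwa [hcol] at hforEach

theorem exec_moveTape (hl : 2 ^ l ≤ w.length + 2) (j : Fin k) (hj : (pos j).1 < l)
    (hj' : (moveCell (pending j) (pos j)).1 < l) :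
    PebbleExec (moveTape e j) (cfgState e w l blank q pending tape pos h)
      {cfgState e w l blank q pending tape
        (Function.update pos j (moveCell (pending j) (pos j))) h} := by
  rw [cfgState_update_pos]
  unfold moveCell at hj' ⊢
  split_ifs at hj' ⊢ with hright hleft
  · exact .iteTrue hright <| (exec_setOff j _).seq_singleton <|
      exec_shiftTape (col := fun j => (pos j).1) fun t col' _ hcol' => by
        have hshift := exec_shift_right (e := e) (w := w)
          (c := (⟨q, Function.update (fun j => (pos j).2) j 0, pending⟩ : Control Q k B))
          (b := contents blank tape) (col := col') (h := h) (t := t) hl (by rwa [hcol'])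
        rwa [hcol'] at hshift
  · obtain ⟨i, hi⟩ := Nat.exists_eq_succ_of_ne_zero hleft.2.2
    refine .iteFalse hright <| .iteTrue ⟨hleft.1, hleft.2.1, decide_eq_false hleft.2.2⟩ <|
      (exec_setOff j _).seq_singleton <|
        exec_shiftTape (col := fun j => (pos j).1) fun t col' _ hcol' => ?_
    exact exec_shift_left hl (by rw [hcol']; omega) (by rwa [hcol'])
  · refine .iteFalse hright <| .iteFalse (fun hmark => hleft ⟨hmark.1, hmark.2.1,
      of_decide_eq_false hmark.2.2⟩) ?_
    rw [Function.update_eq_self]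
    exact exec_setOff j _

theorem exec_moveTapes (hl : 2 ^ l ≤ w.length + 2) (hpos : ∀ j, (pos j).1 < l)
    (hpos' : ∀ j, (moveCell (pending j) (pos j)).1 < l) :
    PebbleExec (moveTapes e) (cfgState e w l blank q pending tape pos h)
      {cfgState e w l blank q pending tape (fun j => moveCell (pending j) (pos j)) h} := by
  have hforEach := Exec.forEach_update (d := pebbleDevice N w) (P := fun _ => True)
    (p := moveTape e) Finset.univ (fun pos => cfgState e w l blank q pending tape pos h) pos
    (fun j => moveCell (pending j) (pos j))
    (fun j _ pos' hj => by
      have := exec_moveTape (e := e) (w := w) (blank := blank) (q := q) (pending := pending)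
        (tape := tape) (pos := pos') (h := h) hl j (by rw [hj]; exact hpos j)
        (by rw [hj]; exact hpos' j)
      rwa [hj] at this) trivial
  rwa [Finset.piecewise_univ] at hforEach

end Machine

section Simulation

variable {α : Type*} {k : ℕ} {M : TuringMachine α k} {w : List α}

theorem space_le (b n : ℕ) : b * (Nat.log 2 n + 1) ≤ (2 * b + 1) * Nat.log 2 (n + 2) := by
  have hlog : Nat.log 2 n ≤ Nat.log 2 (n + 2) := Nat.log_mono_right (Nat.le_add_right ..)
  have hpos : 1 ≤ Nat.log 2 (n + 2) := Nat.log_pos one_lt_two (Nat.le_add_left ..)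
  nlinarith

/-- The effect of a transition on a configuration. -/
def Cfg.apply (x : M.Cfg w) (r : M.Q × (Fin k → M.Γ) × Move × (Fin k → Move)) : M.Cfg w where
  state := r.1
  head := r.2.2.1.onInput x.head
  workHead := fun j => (r.2.2.2 j).onWork (x.workHead j)
  tape := fun j => Function.update (x.tape j) (x.workHead j) (r.2.1 j)

theorem step_iff (x x' : M.Cfg w) : M.Step w x x' ↔
    ∃ r ∈ M.δ x.state (scan w x.head) (fun j => x.tape j (x.workHead j)), x' = x.apply r := by
  obtain ⟨q, h, b, t⟩ := x'
  simp only [Step, Cfg.apply, Prod.exists, Cfg.mk.injEq, funext_iff (f := b), funext_iff (f := t)]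

variable (M) [DecidableEq M.Γ] {B N : ℕ} (e : TrackReg (Track k B M.Γ) ≃ Fin N)

/-- The memory after the choice of transition `r`. The moves of the work heads are pending. -/
def chosen (f : SimMem M.Q M.Γ k B) (r : M.Q × (Fin k → M.Γ) × Move × (Fin k → Move)) :
    SimMem M.Q M.Γ k B :=
  (⟨r.1, f.1.off, r.2.2.2⟩, writeSymbols M.blank f r.2.1)

/-- Perform the part of a transition that does not move the work heads. -/
noncomputable def chooseTransition : PebbleProg α (SimMem M.Q M.Γ k B) N :=
  movePebble (e .input) fun f a =>
    (fun r => (M.chosen f r, r.2.2.1)) '' M.δ f.1.state a (readSymbols M.blank f)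

/-- The simulation of one step. -/
noncomputable def simulateStep [Fintype M.Γ] : PebbleProg α (SimMem M.Q M.Γ k B) N :=
  .seq (M.chooseTransition e) (moveTapes e)

/-- The simulation of a Turing machine. -/
noncomputable def simulation [Fintype M.Γ] : PebbleProg α (SimMem M.Q M.Γ k B) N :=
  .seq dropPebbles (.loop (fun f _ => f.1.state ∉ M.accept) (M.simulateStep e))

theorem det_simulation [Fintype M.Γ] (hM : M.IsDeterministic) : (M.simulation e).Det :=
  ⟨det_dropPebbles, det_movePebble fun _ _ => (hM _ _ _).image _, det_forEach (det_moveTape e)⟩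

variable {M} {e} {l : ℕ}

/-- The relation between the reachable configurations of a Turing machine and the states of the
program that simulates it. -/
def Represents (e : TrackReg (Track k B M.Γ) ≃ Fin N) (l : ℕ) (x : M.Cfg w)
    (s : SimMem M.Q M.Γ k B × PebbleStore α N w) : Prop :=
  M.Reachable w x ∧ ∃ pending pos, (∀ j, x.workHead j = cellIndex (pos j)) ∧
    s = cfgState e w l M.blank x.state pending x.tape pos x.head.val

theorem exec_chooseTransition (x : M.Cfg w) (pending : Fin k → Move)
    (pos : Fin k → ℕ × Fin (B + 1)) (hpos : ∀ j, x.workHead j = cellIndex (pos j)) :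
    PebbleExec (M.chooseTransition e)
      (cfgState e w l M.blank x.state pending x.tape pos x.head.val)
      ((fun r => cfgState e w l M.blank r.1 r.2.2.2 (x.apply r).tape pos (x.apply r).head.val) ''
        M.δ x.state (scan w x.head) (fun j => x.tape j (x.workHead j))) := by
  have hmove := exec_movePebble_regStore (w := w) (e := e) (r := .input) (c := x.head)
    (fun (f : SimMem M.Q M.Γ k B) a =>
      (fun r => (M.chosen f r, r.2.2.1)) '' M.δ f.1.state a (readSymbols M.blank f))
    (cfgState e w l M.blank x.state pending x.tape pos x.head.val).1
    (trackRegs l (contents M.blank x.tape) (fun t => (pos t.1).1) x.head.val) rfl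
  rw [readSymbols_cfgState, Set.image_image] at hmove
  simp only [Cfg.apply, hpos]
  convert hmove using 1
  · rfl
  · rfl
  · exact Set.image_congr fun r _ =>
      cfgState_written (Γ := M.Γ) r.1 r.2.2.2 r.2.1 (r.2.2.1.onInput x.head).val

theorem Represents.exists_exec_simulateStep [Fintype M.Γ] (hl : 2 ^ l ≤ w.length + 2)
    (hspace : ∀ x : M.Cfg w, M.Reachable w x → ∀ j, x.workHead j < (B + 1) * l) {x : M.Cfg w}
    {s : SimMem M.Q M.Γ k B × PebbleStore α N w} (hs : Represents e l x s) :
    ∃ T, PebbleExec (M.simulateStep e) s T ∧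
      (∀ s' ∈ T, ∃ x', M.Step w x x' ∧ Represents e l x' s') ∧
      ∀ x', M.Step w x x' → ∃ s' ∈ T, Represents e l x' s' := by
  obtain ⟨hx, pending, pos, hpos, rfl⟩ := hs
  have hreach : ∀ r ∈ M.δ x.state (scan w x.head) (fun j => x.tape j (x.workHead j)),
      M.Reachable w (x.apply r) := fun r hr => hx.tail ((step_iff _ _).2 ⟨r, hr, rfl⟩)
  have hpos' : ∀ r j, (x.apply r).workHead j = cellIndex (moveCell (r.2.2.2 j) (pos j)) :=
    fun r j => by rw [cellIndex_moveCell, ← hpos, Cfg.apply]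
  have hmoveTapes := fun r hr => exec_moveTapes (e := e) (w := w) (blank := M.blank) (q := r.1)
    (pending := r.2.2.2) (tape := (x.apply r).tape) (pos := pos) (h := (x.apply r).head.val) hl
    (fun j => column_lt (by rw [← hpos]; exact hspace x hx j))
    (fun j => column_lt (by rw [← hpos']; exact hspace _ (hreach r hr) j))
  have hrepresents := fun r hr => show Represents e l (x.apply r) _ from
    ⟨hreach r hr, r.2.2.2, fun j => moveCell (r.2.2.2 j) (pos j), hpos' r, rfl⟩
  refine ⟨_, (exec_chooseTransition x pending pos hpos).seq_image hmoveTapes, ?_, ?_⟩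
  · rintro _ ⟨r, hr, rfl⟩
    exact ⟨x.apply r, (step_iff _ _).2 ⟨r, hr, rfl⟩, hrepresents r hr⟩
  · intro x' hx'
    obtain ⟨r, hr, rfl⟩ := (step_iff _ _).1 hx'
    exact ⟨_, ⟨r, hr, rfl⟩, hrepresents r hr⟩

/-- The initial memory for the simulation. -/
def initMem (M : TuringMachine α k) (B : ℕ) : SimMem M.Q M.Γ k B :=
  (⟨M.start, fun _ => 0, fun _ => .stay⟩, fun t => t.2.isNone)

theorem contents_blank (j : Fin k) (x : Fin (B + 1) × M.Γ) (i : ℕ) :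
    contents M.blank (M.init w).tape (j, some x) i = false := code_blank ..

theorem represents_init :
    Represents e l (M.init w) (M.initMem B, (cellStore (fun _ => 0) 0 : PebbleStore α N w)) := by
  have hregs : ∀ r, trackRegs l (contents M.blank (M.init w).tape)
      (fun _ : Track k B M.Γ => 0) 0 r = 0 := by
    intro r
    match r with
    | .input => rfl
    | .aux => rfl
    | .side false t => rfl
    | .side true (j, none) =>
      exact rightVal_eq_zero _ fun i hi => decide_eq_false (Nat.ne_of_gt hi)
    | .side true (j, some x) => exact rightVal_eq_zero _ fun i _ => contents_blank j x i
  refine ⟨.refl, fun _ => .stay, fun _ => (0, 0), fun _ => (Nat.zero_mul _).symm,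
    Prod.ext (Prod.ext rfl ?_) ?_⟩
  · funext t
    match t with
    | (j, none) => rfl
    | (j, some x) => exact (contents_blank j x 0).symm
  · refine congrArg (fun v => cellStore v 0) (funext fun i => Fin.ext ?_)
    exact ((congrArg (min · _) (hregs (e.symm i))).trans (Nat.zero_min _)).symm

theorem exists_exec_simulation [Fintype M.Γ] (hl : 2 ^ l ≤ w.length + 2)
    (hspace : ∀ x : M.Cfg w, M.Reachable w x → ∀ j, x.workHead j < (B + 1) * l) :
    ∃ T, PebbleExec (M.simulation e)
        (M.initMem B, (⟨0, fun _ => none⟩ : PebbleStore α N w)) T ∧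
      (T.Nonempty ↔ w ∈ M.language) := by
  obtain ⟨T, hT, hiff⟩ := Exec.exists_loop_nonempty_iff (d := pebbleDevice N w)
    (step := M.Step w) (t := fun (f : SimMem M.Q M.Γ k B) _ => f.1.state ∉ M.accept)
    (acc := fun x => x.state ∈ M.accept) (R := Represents e l) (P := fun _ => True)
    (fun _ _ _ => trivial) (fun x r ⟨_, _, _, _, hr⟩ => by rw [hr]; rfl)
    (fun x r hr _ => hr.exists_exec_simulateStep hl hspace) represents_init
  exact ⟨T, (exec_dropPebbles _ _).seq_singleton hT, hiff⟩

end Simulation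

theorem exists_pebbleAutomaton {α : Type*} {k : ℕ} (M : TuringMachine α k) (hM : M.IsLogspace) :
    ∃ (m : ℕ) (P : PebbleAutomaton α m),
      (M.IsDeterministic → P.IsDeterministic) ∧ P.language = M.language := by
  classical
  have := M.finite_Q
  have := M.finite_Γ
  have := Fintype.ofFinite M.Γ
  obtain ⟨b, hb⟩ := hM
  obtain ⟨N, ⟨e⟩⟩ := Finite.exists_equiv_fin (TrackReg (Track k (2 * b) M.Γ))
  refine ⟨N, (M.simulation e).toPebble (M.initMem (2 * b)),
    fun hM => toPebble_isDeterministic (M.det_simulation e hM), ?_⟩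
  ext w
  obtain ⟨T, hT, hiff⟩ := exists_exec_simulation (e := e)
    (Nat.pow_log_le_self 2 (by omega : w.length + 2 ≠ 0))
    fun x hx j => (hb w x hx j).trans_le (space_le b w.length)
  exact (mem_language_toPebble hT).trans hiff

end TuringMachine

end PebbleLogspace

theorem mainTheorem10_general (α : Type*) :
    (PebbleLogspace.LOGSPACE α = ⋃ m : ℕ, PebbleLogspace.REG α m) ∧
    (PebbleLogspace.NLOGSPACE α = ⋃ m : ℕ, PebbleLogspace.NREG α m) := by
  refine ⟨Set.ext fun L => ⟨?_, ?_⟩, Set.ext fun L => ⟨?_, ?_⟩⟩ <;> rw [Set.mem_iUnion]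
  · rintro ⟨k, M, hdet, hlog, rfl⟩
    obtain ⟨m, P, hP, hlang⟩ := M.exists_pebbleAutomaton hlog
    exact ⟨m, P, hP hdet, hlang⟩
  · rintro ⟨m, M, hdet, rfl⟩
    obtain ⟨T, hT, hlog, hlang⟩ := M.exists_turingMachine
    exact ⟨1, T, hT hdet, hlog, hlang⟩
  · rintro ⟨k, M, hlog, rfl⟩
    obtain ⟨m, P, -, hlang⟩ := M.exists_pebbleAutomaton hlog
    exact ⟨m, P, hlang⟩
  · rintro ⟨m, M, rfl⟩
    obtain ⟨T, -, hlog, hlang⟩ := M.exists_turingMachine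
    exact ⟨1, T, hlog, hlang⟩

theorem mainTheorem10 (α : Type*) [Finite α] :
    (PebbleLogspace.LOGSPACE α = ⋃ m : ℕ, PebbleLogspace.REG α m) ∧
    (PebbleLogspace.NLOGSPACE α = ⋃ m : ℕ, PebbleLogspace.NREG α m) :=
  mainTheorem10_general α
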